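/- For $e\in C[0,\pi]$ let $L_e y=-y_{xx}-y-e(x)y$ on $(0,\pi)$ with Dirichlet boundary conditions, let $J_e(\varphi,\psi)=\int_0^\pi(\varphi_x\psi_x-\varphi\psi-e\varphi\psi)\,dx$ be its bilinear form on $H^1_0(0,\pi)$, and let $\lambda_e$ be its first (smallest) eigenvalue; eigenfunctions are understood weakly in $H_0^1(0,\pi)$. For $T>0$, $g\in C[0,\pi]$ and $f\in L^2(0,\pi)$ consider $$y_t-y_{xx}-y-g(x)y=f(x)\ \text{ in }(0,\pi)\times(0,T),\qquad y(0,t)=y(\pi,t)=0.\tag{$P_g$}$$ A periodic solution of $(P_g)$ is a weak solution $y\in C([0,T];L^2(0,\pi))\cap L^2(0,T;H^1_0(0,\pi))$ with $y(\cdot,0)=y(\cdot,T)$. (a) For every $e\in C[0,\pi]$, the operator $L_e$ has a smallest eigenvalue $\lambda_e$, and $\lambda_e=\min\{J_e(\varphi,\varphi):\varphi\in H^1_0(0,\pi),\ \|\varphi\|_{L^2(0,\pi)}=1\}$ (the minimum is attained). Moreover $|\lambda_e|\le\max_{[0,\pi]}|e|$; and $\lambda_e\to0$ and $e+\lambda_e\to0$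 uniformly on $[0,\pi]$ as $e\to0$ uniformly on $[0,\pi]$. For $e=0$ one has $\lambda_0=0$, and the eigenfunctions for the eigenvalue $0$ of $L_0$ are exactly the nonzero multiples of $\sin x$. Let $T>0$. (b) If $e\in C[0,\pi]$ is such that $0$ is an eigenvalue of $L_e$, and $f\in L^2(0,\pi)$, then $(P_e)$ has a periodic solution if and only if $\int_0^\pi fX\,dx=0$ for every eigenfunction $X$ of $L_e$ for the eigenvalue $0$. In particular $(P_0)$ has a periodic solution if and only if $\int_0^\pi f(x)\sin x\,dx=0$. (c) Let $e\in C[0,\pi]$ and let $\varphi_e$ be an eigenfunction of $L_e$ for $\lambda_e$ with $\|\varphi_e\|_{L^2(0,\pi)}=1$. Then for $f\in L^2(0,\pi)$ the problem $(P_{e+\lambda_e})$, that is $y_t-y_{xx}-y-(e(x)+\lambda_e)y=f$, has a periodic solution if and only if $\int_0^\pi f\varphi_e\,dx=0$. (d) Let $e\in C[0,\pi]$ be non-constant. Then there is an integer $j\ge2$ such that for $f(x)=\sin jx$ the unperturbed problem $(P_0)$ has a periodic solution while $(P_{e+\lambda_e})$ has none. The set of $f\in L^2(0,\pi)$ for which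 $(P_{e+\lambda_e})$ has no periodic solution is open and dense in $L^2(0,\pi)$; and among the $f\in L^2(0,\pi)$ for which $(P_0)$ has a periodic solution, those for which $(P_{e+\lambda_e})$ has none form a (relatively open and) dense subset. (e) For every $\varepsilon>0$ there are a non-constant $e\in C[0,\pi]$ with $\max_{[0,\pi]}|e+\lambda_e|<\varepsilon$ and an $f\in L^2(0,\pi)$ such that $(P_0)$ has a periodic solution and $(P_{e+\lambda_e})$ has none. -/

import Mathlib

open MeasureTheory Set Filter Topology
open scoped ContDiff

noncomputable section

namespace ParabolicExample

/-- The space `L²(0,π)`. -/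
abbrev L2 : Type := Lp ℝ 2 (volume.restrict (Ioo (0 : ℝ) Real.pi))

/-- The space `C[0,π]`; its norm is the maximum norm `max |e(x)|`. -/
abbrev C0 : Type := C(Icc (0 : ℝ) Real.pi, ℝ)

/-- The value `e(x)` for a real number `x` (the relevant `x` lie in `[0,π]`). -/
def val (e : C0) (x : ℝ) : ℝ := Set.IccExtend Real.pi_pos.le e x

/-- The integral `∫₀^π u v dx`. -/
def pairing (u v : L2) : ℝ := ∫ x in Ioo (0 : ℝ) Real.pi, u x * v x

/-- The pairs `(φ, φ')` with `φ` a smooth function with compact support in `(0,π)`. -/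
def testPairs : Set (L2 × L2) :=
  {p | ∃ φ : ℝ → ℝ, ContDiff ℝ ∞ φ ∧ HasCompactSupport φ ∧ tsupport φ ⊆ Ioo 0 Real.pi ∧
    p.1 =ᵐ[volume.restrict (Ioo (0 : ℝ) Real.pi)] φ ∧
    p.2 =ᵐ[volume.restrict (Ioo (0 : ℝ) Real.pi)] deriv φ}

/-- The Sobolev space `H¹₀(0,π)`, as the closure of the smooth compactly supported functions in the
`H¹` norm. An element `u` is recorded together with its weak derivative, as the pair `(u, u_x)`. -/
def H10 : Set (L2 × L2) := closure testPairs

/-- The bilinear form `J_e(u,v) = ∫₀^π (u_x v_x - u v - e u v) dx` of the operator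
`L_e u = - u_xx - u - e u`, on pairs `p = (u, u_x)`, `q = (v, v_x)`. -/
def J (e : C0) (p q : L2 × L2) : ℝ :=
  ∫ x in Ioo (0 : ℝ) Real.pi, (p.2 x * q.2 x - p.1 x * q.1 x - val e x * p.1 x * q.1 x)

/-- `u ≠ 0` lies in `H¹₀(0,π)` and is a weak solution of `L_e u = lam u`. -/
def IsEigenfunction (e : C0) (lam : ℝ) (u : L2) : Prop :=
  u ≠ 0 ∧ ∃ ux : L2, (u, ux) ∈ H10 ∧ ∀ q ∈ H10, J e (u, ux) q = lam * pairing u q.1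

/-- The set of the (real) Dirichlet eigenvalues of `L_e`. -/
def eigenvalues (e : C0) : Set ℝ := {lam | ∃ u : L2, IsEigenfunction e lam u}

/-- The first Dirichlet eigenvalue `λ_e` of `L_e`. -/
def firstEigenvalue (e : C0) : ℝ := sInf (eigenvalues e)

/-- The values `J_e(φ,φ)` for `φ` in `H¹₀(0,π)` with `‖φ‖ = 1` in `L²(0,π)`. -/
def rayleighValues (e : C0) : Set ℝ := {r | ∃ p ∈ H10, ‖p.1‖ = 1 ∧ r = J e p p}

/-- The perturbation `e(x) + λ_e`. -/
def shifted (e : C0) : C0 := e + ContinuousMap.const _ (firstEigenvalue e)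

/-- `y ∈ C([0,T]; L²(0,π)) ∩ L²(0,T; H¹₀(0,π))` is a weak solution of
`y_t - y_xx - y - g(x) y = f(x)` on `(0,π) × (0,T)` with `y(0,t) = y(π,t) = 0`: for every `v` in
`H¹₀(0,π)`, the identity `d/dt ∫ y v dx + J_g(y,v) = ∫ f v dx` holds in the sense of distributions
on `(0,T)`. Here `yx` is the weak derivative of `y` in the space variable. -/
def IsWeakSolution (g : C0) (T : ℝ) (f : L2) (y : ℝ → L2) : Prop :=
  ContinuousOn y (Icc 0 T) ∧
  ∃ yx : ℝ → L2, MemLp yx 2 (volume.restrict (Ioo 0 T)) ∧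
    (∀ᵐ t ∂(volume.restrict (Ioo 0 T)), (y t, yx t) ∈ H10) ∧
    ∀ q ∈ H10, ∀ η : ℝ → ℝ, ContDiff ℝ ∞ η → HasCompactSupport η → tsupport η ⊆ Ioo 0 T →
      -(∫ t in Ioo 0 T, pairing (y t) q.1 * deriv η t)
        + (∫ t in Ioo 0 T, J g (y t, yx t) q * η t)
        = ∫ t in Ioo 0 T, pairing f q.1 * η t

/-- The equation `y_t - y_xx - y - g(x) y = f(x)` with Dirichlet conditions has a periodic solution,
that is, a weak solution with `y(·,0) = y(·,T)`. -/
def HasPeriodicSolution (g : C0) (T : ℝ) (f : L2) : Prop :=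
  ∃ y : ℝ → L2, IsWeakSolution g T f y ∧ y 0 = y T

/-- The function `e` is constant on `[0,π]`. -/
def IsConst (e : C0) : Prop := ∃ c : ℝ, ∀ x, e x = c

end ParabolicExample

end

/-! An element of `H10` is determined by its weak derivative: `v ↦ (prim v, v)`, with `prim`
integration from 0, is a bijection from the mean-zero functions onto `H10` (`mem_H10_iff`). In this
coordinate the form is `J e = ⟨v - B v, w⟩` with `B` symmetric and compact, because `prim` is
compact by Arzelà–Ascoli. The Fredholm alternative then solves `L_e w = f` weakly whenever `f` is
orthogonal to the kernel (`exists_forall_J_eq`). The kernel is at most one-dimensional, since a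
solution of the second-order ODE with `u(0) = 0` is determined by `u'(0)`
(`InKernel.exists_smul_eq`).

Periodicity reduces to this elliptic problem. If `X` is in the kernel and `y` is a weak solution,
then `∫ y X` is affine in time with slope `∫ f X`, so periodicity forces `∫ f X = 0`. Conversely, a
solution of `L_e w = f` is a stationary, hence periodic, solution
(`hasPeriodicSolution_iff_inKernel`).

The first eigenvalue is the minimum of the Rayleigh quotient. Wirtinger's inequality bounds it below
by `-‖e‖`, and the trial function `sin` bounds it above by `‖e‖`. Passing to `e + λ_e` makes 0 an
eigenvalue, with some eigenfunction `X`. If `e` is not constant, then `g = e + λ_e` is not zero, and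
`X` cannot be a multiple of `sin`, for that would give `g sin = 0`. By completeness of the sines,
`X` has a nonzero coefficient against some `sin (j x)` with `j ≥ 2`. This right-hand side is
orthogonal to `sin` but not to `X`. Openness and density hold because solvability is one continuous
linear condition that this direction violates. -/

noncomputable section

namespace ParabolicExample

/-! ### Multiplication by continuous functions -/

/-- Lebesgue measure on `(0,π)`. -/
abbrev μI : Measure ℝ := volume.restrict (Ioo (0 : ℝ) Real.pi)

theorem continuous_val (e : C0) : Continuous (val e) := e.continuous.Icc_extend'

theorem abs_val_le (e : C0) (x : ℝ) : |val e x| ≤ ‖e‖ := e.norm_coe_le_norm _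

theorem val_of_mem (e : C0) {x : ℝ} (hx : x ∈ Icc 0 Real.pi) : val e x = e ⟨x, hx⟩ :=
  IccExtend_of_mem _ _ hx

theorem val_add (e g : C0) (x : ℝ) : val (e + g) x = val e x + val g x := rfl

theorem val_mul (e g : C0) (x : ℝ) : val (e * g) x = val e x * val g x := rfl

theorem val_smul (c : ℝ) (e : C0) (x : ℝ) : val (c • e) x = c * val e x := rfl

theorem val_const (c x : ℝ) : val (ContinuousMap.const _ c) x = c := rfl

theorem memLp_val_mul (e : C0) (u : L2) : MemLp (fun x => val e x * u x) 2 μI :=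
  (Lp.memLp u).of_le_mul (c := ‖e‖)
    ((continuous_val e).aestronglyMeasurable.mul (Lp.aestronglyMeasurable u))
    (.of_forall fun x => by
      rw [norm_mul]
      exact mul_le_mul_of_nonneg_right (abs_val_le e x) (norm_nonneg _))

/-- Multiplication of an `L²` function by a continuous function. -/
def mulOp : C0 →L[ℝ] L2 →L[ℝ] L2 :=
  LinearMap.mkContinuous₂
    (LinearMap.mk₂ ℝ (fun e u => (memLp_val_mul e u).toLp _)
      (fun e g u => by
        rw [← MemLp.toLp_add]
        exact MemLp.toLp_congr _ _ (.of_forall fun x => by simp [val_add, add_mul]))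
      (fun c e u => by
        rw [← MemLp.toLp_const_smul]
        exact MemLp.toLp_congr _ _ (.of_forall fun x => by simp [val_smul, mul_assoc]))
      (fun e u v => by
        rw [← MemLp.toLp_add]
        refine MemLp.toLp_congr _ _ ?_
        filter_upwards [Lp.coeFn_add u v] with x hx
        change val e x * (u + v : L2) x = val e x * u x + val e x * v x
        rw [hx, Pi.add_apply, mul_add])
      (fun c e u => by
        rw [← MemLp.toLp_const_smul]
        refine MemLp.toLp_congr _ _ ?_
        filter_upwards [Lp.coeFn_smul c u] with x hx
        simp [hx]; ring)) 1
    (fun e u => by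
      rw [one_mul]
      refine Lp.norm_le_mul_norm_of_ae_le_mul ?_
      filter_upwards [(memLp_val_mul e u).coeFn_toLp] with x hx
      simp only [LinearMap.mk₂_apply]
      rw [hx, norm_mul]
      exact mul_le_mul_of_nonneg_right (abs_val_le e x) (norm_nonneg _))

theorem mulOp_ae (e : C0) (u : L2) : mulOp e u =ᵐ[μI] fun x => val e x * u x :=
  (memLp_val_mul e u).coeFn_toLp

theorem norm_mulOp_apply_le (e : C0) (u : L2) : ‖mulOp e u‖ ≤ ‖e‖ * ‖u‖ := by
  refine Lp.norm_le_mul_norm_of_ae_le_mul ?_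
  filter_upwards [mulOp_ae e u] with x hx
  rw [hx, norm_mul]
  exact mul_le_mul_of_nonneg_right (abs_val_le e x) (norm_nonneg _)

/-! ### The primitive operator and its compactness -/

theorem measure_Iic_ne_top (x : ℝ) : μI (Iic x) ≠ ⊤ := measure_ne_top _ _

/-- The indicator function of `(0,x]` in `L²(0,π)`. -/
def step (x : ℝ) : L2 := indicatorConstLp 2 measurableSet_Iic (measure_Iic_ne_top x) (1 : ℝ)

/-- The constant function `1` in `L²(0,π)`. -/
def one : L2 := step Real.pi

theorem one_ae : one =ᵐ[μI] fun _ => (1 : ℝ) := by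
  have h : one =ᵐ[μI] (Iic Real.pi).indicator fun _ => (1 : ℝ) := indicatorConstLp_coeFn (hs := measurableSet_Iic)
      (hμs := measure_Iic_ne_top _)
  filter_upwards [h, ae_restrict_mem measurableSet_Ioo] with x hx hx'
  rw [hx, indicator_of_mem (show x ∈ Iic Real.pi from hx'.2.le)]

/-- A continuous function as an element of `L²(0,π)`. -/
def toL2 : C0 →L[ℝ] L2 := mulOp.flip one

theorem toL2_ae (e : C0) : toL2 e =ᵐ[μI] val e := by
  filter_upwards [mulOp_ae e one, one_ae] with x hx h1
  change mulOp e one x = _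
  rw [hx, h1, mul_one]

/-- The half-lines up to `x` and up to `y` differ by a set of measure at most `|y - x|`. This
continuity is what makes primitives of bounded `L²` families equicontinuous. -/
theorem continuous_step : Continuous step := by
  refine continuous_indicatorConstLp_set (by simp) fun x => ?_
  have hb : ∀ y, μI (symmDiff (Iic y) (Iic x)) ≤ ENNReal.ofReal |y - x| := fun y => by
    refine (Measure.restrict_apply_le _ _).trans ?_
    refine (measure_mono (t := uIcc x y) ?_).trans (by rw [Real.volume_interval])
    intro z hz
    rw [mem_uIcc]
    rcases hz with ⟨h1, h2⟩ | ⟨h1, h2⟩ <;> simp only [mem_Iic, not_le] at h1 h2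
    · exact .inl ⟨h2.le, h1⟩
    · exact .inr ⟨h2.le, h1⟩
  refine tendsto_of_tendsto_of_tendsto_of_le_of_le tendsto_const_nhds ?_ (fun _ => zero_le) hb
  have : Continuous fun y : ℝ => ENNReal.ofReal |y - x| := 
    ENNReal.continuous_ofReal.comp (by fun_prop)
  simpa using this.tendsto x

theorem inner_step (x : ℝ) (f : L2) : inner ℝ (step x) f = ∫ t in Iic x, f t ∂μI :=
  L2.inner_indicatorConstLp_one _ _ f

theorem norm_step_le (x : ℝ) : ‖step x‖ ≤ ‖one‖ := by
  refine Lp.norm_le_norm_of_ae_le ?_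
  have h : step x =ᵐ[μI] (Iic x).indicator fun _ => (1 : ℝ) := indicatorConstLp_coeFn (hs := measurableSet_Iic)
      (hμs := measure_Iic_ne_top _)
  filter_upwards [h, one_ae] with t ht h1
  rw [ht, h1]
  by_cases h : t ∈ Iic x <;> simp [h]

/-- The primitive `x ↦ ∫₀ˣ f` of an `L²` function, as a continuous function. -/
def primC : L2 →L[ℝ] C0 :=
  LinearMap.mkContinuous
    { toFun := fun f => ⟨fun x => inner ℝ (step x) f,
        (continuous_step.comp continuous_subtype_val).inner continuous_const⟩
      map_add' := fun f g => by
        ext x; exact inner_add_right (step x) f g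
      map_smul' := fun c f => by
        ext x; exact real_inner_smul_right (step x) f c } ‖one‖
    (fun f => by
      rw [ContinuousMap.norm_le _ (by positivity)]
      intro x
      exact (norm_inner_le_norm _ _).trans
        (mul_le_mul_of_nonneg_right (norm_step_le _) (norm_nonneg _)))

theorem primC_apply (f : L2) (x : Icc 0 Real.pi) : primC f x = inner ℝ (step x) f := rfl

/-- Arzelà–Ascoli: on the unit ball the primitives are bounded by `‖one‖`, and by Cauchy–Schwarz
their oscillation is controlled by `‖step y - step x‖`. -/
theorem isCompactOperator_primC : IsCompactOperator primC := by
  have key := isCompactOperator_iff_image_closedBall_subset_compact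
    (primC : L2 →ₗ[ℝ] C0) (r := 1) one_pos
  refine key.2 ?_
  let Φ := ContinuousMap.linearIsometryBoundedOfCompact (Icc (0 : ℝ) Real.pi) ℝ ℝ
  let A : Set (BoundedContinuousFunction (Icc (0 : ℝ) Real.pi) ℝ) :=
    (fun f => Φ (primC f)) '' Metric.closedBall 0 1
  have hA : IsCompact (closure A) := by
    refine BoundedContinuousFunction.arzela_ascoli (Metric.closedBall 0 ‖one‖)
      (isCompact_closedBall _ _) A ?_ ?_
    · rintro _ x ⟨f, hf, rfl⟩
      rw [mem_closedBall_zero_iff] at hf ⊢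
      change ‖(inner ℝ (step x) f : ℝ)‖ ≤ _
      calc _ ≤ ‖step x‖ * ‖f‖ := norm_inner_le_norm _ _
        _ ≤ ‖one‖ * 1 := mul_le_mul (norm_step_le _) hf (norm_nonneg _) (norm_nonneg _)
        _ = _ := mul_one _
    · intro x
      rw [Metric.equicontinuousAt_iff_right]
      intro ε hε
      have hc : Continuous fun y : Icc (0 : ℝ) Real.pi => step y :=
        continuous_step.comp continuous_subtype_val
      filter_upwards [Metric.tendsto_nhds.1 (hc.tendsto x) ε hε] with y hy
      rintro ⟨_, f, hf, rfl⟩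
      rw [mem_closedBall_zero_iff] at hf
      change dist (inner ℝ (step x) f : ℝ) (inner ℝ (step y) f) < ε
      rw [dist_comm, dist_eq_norm, ← inner_sub_left]
      rw [dist_eq_norm] at hy
      calc _ ≤ ‖step y - step x‖ * ‖f‖ := norm_inner_le_norm _ _
        _ ≤ ‖step y - step x‖ * 1 := mul_le_mul_of_nonneg_left hf (norm_nonneg _)
        _ < ε := by rwa [mul_one]
  refine ⟨Φ.symm '' closure A, hA.image Φ.symm.continuous, ?_⟩
  rintro _ ⟨f, hf, rfl⟩
  exact ⟨Φ (primC f), subset_closure ⟨f, hf, rfl⟩, Φ.symm_apply_apply _⟩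

/-- The primitive as an operator on `L²(0,π)`. -/
def prim : L2 →L[ℝ] L2 := toL2.comp primC

theorem isCompactOperator_prim : IsCompactOperator prim :=
  isCompactOperator_primC.clm_comp toL2

/-! ### Integrals as inner products -/

theorem integrableOn_coe (f : L2) : IntegrableOn f (Ioo 0 Real.pi) :=
  (Lp.memLp f).integrable (by norm_num)

theorem val_primC (f : L2) {g : ℝ → ℝ} (h : f =ᵐ[μI] g) {x : ℝ} (hx : x ∈ Icc 0 Real.pi) :
    val (primC f) x = ∫ t in (0)..x, g t := by
  rw [val_of_mem _ hx, primC_apply, inner_step, intervalIntegral.integral_of_le hx.1,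
    integral_congr_ae (ae_restrict_of_ae h), Measure.restrict_restrict measurableSet_Iic]
  refine setIntegral_congr_set ?_
  have : Iic x ∩ Icc 0 Real.pi = Icc 0 x := by
    ext t; simp only [mem_inter_iff, mem_Iic, mem_Icc]
    exact ⟨fun h => ⟨h.2.1, h.1⟩, fun h => ⟨h.2, h.1, h.2.trans hx.2⟩⟩
  have h1 : (Iic x ∩ Ioo 0 Real.pi : Set ℝ) =ᵐ[volume] (Iic x ∩ Icc 0 Real.pi : Set ℝ) :=
    (ae_eq_refl _).inter Ioo_ae_eq_Icc
  refine h1.trans ?_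
  rw [this]
  exact Ioc_ae_eq_Icc.symm

theorem inner_eq (u v : L2) : inner ℝ u v = ∫ x in Ioo 0 Real.pi, u x * v x := by
  rw [L2.inner_def]
  refine integral_congr_ae (.of_forall fun x => ?_)
  simp [mul_comm]

theorem integrable_mul (u v : L2) : Integrable (fun x => u x * v x) μI := by
  refine (L2.integrable_inner (𝕜 := ℝ) u v).congr (.of_forall fun x => ?_)
  simp [mul_comm]

theorem pairing_eq (u v : L2) : pairing u v = inner ℝ u v := (inner_eq u v).symm

theorem J_eq (e : C0) (p q : L2 × L2) :
    J e p q = inner ℝ p.2 q.2 - inner ℝ p.1 q.1 - inner ℝ (mulOp e p.1) q.1 := by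
  have h1 := integral_sub (integrable_mul p.2 q.2) (integrable_mul p.1 q.1)
  have h2 := integral_sub ((integrable_mul p.2 q.2).sub (integrable_mul p.1 q.1))
    (integrable_mul (mulOp e p.1) q.1)
  simp only [Pi.sub_apply] at h2
  rw [inner_eq, inner_eq, inner_eq, ← h1, ← h2]
  refine integral_congr_ae ?_
  filter_upwards [mulOp_ae e p.1] with x hx
  rw [hx]

theorem inner_mulOp_comm (e : C0) (u v : L2) : inner ℝ (mulOp e u) v = inner ℝ u (mulOp e v) := by
  rw [inner_eq, inner_eq]
  refine integral_congr_ae ?_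
  filter_upwards [mulOp_ae e u, mulOp_ae e v] with x hx hx'
  rw [hx, hx']; ring

theorem mulOp_const (c : ℝ) (u : L2) : mulOp (ContinuousMap.const _ c) u = c • u := by
  refine Lp.ext ?_
  filter_upwards [mulOp_ae (ContinuousMap.const _ c) u, Lp.coeFn_smul c u] with x hx hx'
  rw [hx, hx', val_const]; rfl

theorem mulOp_toL2 (e g : C0) : mulOp e (toL2 g) = toL2 (e * g) := by
  refine Lp.ext ?_
  filter_upwards [mulOp_ae e (toL2 g), toL2_ae g, toL2_ae (e * g)] with x h1 h2 h3
  rw [h1, h2, h3, val_mul]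

/-! ### Test functions and the du Bois-Reymond lemma -/

theorem exists_tsupport_subset_Icc {a b : ℝ} (hab : a < b) {η : ℝ → ℝ}
    (h1 : HasCompactSupport η) (h2 : tsupport η ⊆ Ioo a b) :
    ∃ c d, a < c ∧ c ≤ d ∧ d < b ∧ tsupport η ⊆ Icc c d := by
  rcases (tsupport η).eq_empty_or_nonempty with h | h
  · exact ⟨(a + b) / 2, (a + b) / 2, by linarith, le_rfl, by linarith, by simp [h]⟩
  · obtain ⟨c, hc⟩ := h1.isCompact.exists_isLeast h
    obtain ⟨d, hd⟩ := h1.isCompact.exists_isGreatest h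
    exact ⟨c, d, (h2 hc.1).1, hc.2 hd.1, (h2 hd.1).2, fun x hx => ⟨hc.2 hx, hd.2 hx⟩⟩

theorem setIntegral_Ioo_eq {a b : ℝ} {η : ℝ → ℝ} (h2 : tsupport η ⊆ Ioo a b) :
    ∫ x in Ioo a b, η x = ∫ x, η x :=
  setIntegral_eq_integral_of_forall_compl_eq_zero fun _ hx =>
    image_eq_zero_of_notMem_tsupport fun h => hx (h2 h)

/-- The primitive from `a` vanishes to the left of the support of `ζ`, and the zero total integral
makes it vanish to the right as well. -/
theorem exists_testFunction_deriv_eq {a b : ℝ} (hab : a < b) {ζ : ℝ → ℝ}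
    (h0 : ContDiff ℝ ∞ ζ) (h1 : HasCompactSupport ζ) (h2 : tsupport ζ ⊆ Ioo a b)
    (h3 : ∫ x, ζ x = 0) :
    ∃ η : ℝ → ℝ, ContDiff ℝ ∞ η ∧ HasCompactSupport η ∧ tsupport η ⊆ Ioo a b ∧ deriv η = ζ := by
  obtain ⟨c, d, hc, hcd, hd, hs⟩ := exists_tsupport_subset_Icc hab h1 h2
  have hz : ∀ x, x ∉ Icc c d → ζ x = 0 := fun x hx =>
    image_eq_zero_of_notMem_tsupport fun h => hx (hs h)
  let η : ℝ → ℝ := fun x => ∫ t in a..x, ζ t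
  have hder : ∀ x, HasDerivAt η (ζ x) x := fun x => h0.continuous.integral_hasStrictDerivAt a x
    |>.hasDerivAt
  have hd' : deriv η = ζ := funext fun x => (hder x).deriv
  have hη : ∀ x, x ∉ Icc c d → η x = 0 := by
    intro x hx
    rw [mem_Icc, not_and_or, not_le, not_le] at hx
    rcases hx with hx | hx
    · refine intervalIntegral.integral_zero_ae (.of_forall fun t ht => hz t fun h => ?_)
      rw [mem_uIoc] at ht
      rcases ht with ht | ht <;> linarith [ht.1, ht.2, h.1]
    · rw [← h3]
      refine intervalIntegral.integral_eq_integral_of_support_subset ?_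
      intro t ht
      have := hs (subset_tsupport _ ht)
      exact ⟨hc.trans_le this.1, this.2.trans hx.le⟩
  refine ⟨η, ?_, HasCompactSupport.intro isCompact_Icc hη, ?_, hd'⟩
  · rw [contDiff_infty_iff_deriv, hd']
    exact ⟨fun x => (hder x).differentiableAt, h0⟩
  · refine (closure_minimal ?_ isClosed_Icc).trans (Icc_subset_Ioo hc hd)
    intro x hx
    by_contra h
    exact hx (hη x h)

theorem exists_testFunction_integral_one {a b : ℝ} (hab : a < b) :
    ∃ ρ : ℝ → ℝ, ContDiff ℝ ∞ ρ ∧ HasCompactSupport ρ ∧ tsupport ρ ⊆ Ioo a b ∧ ∫ x, ρ x = 1 := by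
  let ρ : ContDiffBump ((a + b) / 2) := ⟨(b - a) / 8, (b - a) / 4, by linarith, by linarith⟩
  refine ⟨ρ.normed volume, ρ.contDiff_normed, ρ.hasCompactSupport_normed, ?_, ρ.integral_normed⟩
  rw [ρ.tsupport_normed_eq, Real.closedBall_eq_Icc]
  refine Icc_subset_Ioo ?_ ?_
  · change a < (a + b) / 2 - (b - a) / 4; linarith
  · change (a + b) / 2 + (b - a) / 4 < b; linarith

theorem integrableOn_mul_of_testFunction {a b : ℝ} {k η : ℝ → ℝ} (hk : IntegrableOn k (Ioo a b))
    (h0 : Continuous η) (h1 : HasCompactSupport η) :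
    IntegrableOn (fun x => k x * η x) (Ioo a b) := by
  obtain ⟨C, hC⟩ := h1.exists_bound_of_continuous h0
  exact hk.mul_bdd h0.aestronglyMeasurable (.of_forall hC)

/-- The lemma of du Bois-Reymond: an integrable function on `(a,b)` with vanishing weak derivative
is constant. -/
theorem ae_eq_const_of_integral_mul_deriv_eq_zero {a b : ℝ} (hab : a < b) {k : ℝ → ℝ}
    (hk : IntegrableOn k (Ioo a b))
    (h : ∀ η : ℝ → ℝ, ContDiff ℝ ∞ η → HasCompactSupport η → tsupport η ⊆ Ioo a b →
      ∫ x in Ioo a b, k x * deriv η x = 0) :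
    ∃ C, ∀ᵐ x ∂volume.restrict (Ioo a b), k x = C := by
  obtain ⟨ρ, r0, r1, r2, r3⟩ := exists_testFunction_integral_one hab
  refine ⟨∫ x in Ioo a b, k x * ρ x, ?_⟩
  set C := ∫ x in Ioo a b, k x * ρ x with hC
  have hkC : IntegrableOn (fun x => k x - C) (Ioo a b) := hk.sub (integrable_const C)
  rw [ae_restrict_iff' measurableSet_Ioo]
  suffices H : ∀ᵐ x, x ∈ Ioo a b → k x - C = 0 by
    filter_upwards [H] with x hx hx'
    linarith [hx hx']
  refine isOpen_Ioo.ae_eq_zero_of_integral_contDiff_smul_eq_zero hkC.locallyIntegrableOn ?_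
  intro g g0 g1 g2
  -- Subtracting the multiple of `ρ` with the same integral as `g` leaves the derivative of a test
  -- function.
  let ζ : ℝ → ℝ := fun x => g x - (∫ x, g x) * ρ x
  have hgi : Integrable g := g0.continuous.integrable_of_hasCompactSupport g1
  have hri : Integrable ρ := r0.continuous.integrable_of_hasCompactSupport r1
  have hsup : Function.support ζ ⊆ tsupport g ∪ tsupport ρ := by
    intro x hx
    by_contra hn
    rw [mem_union, not_or] at hn
    refine hx ?_
    simp [ζ, image_eq_zero_of_notMem_tsupport hn.1, image_eq_zero_of_notMem_tsupport hn.2]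
  have z0 : ContDiff ℝ ∞ ζ := g0.sub (contDiff_const.mul r0)
  have z1 : HasCompactSupport ζ := HasCompactSupport.of_support_subset_isCompact
    (g1.isCompact.union r1.isCompact) hsup
  have z2 : tsupport ζ ⊆ Ioo a b :=
    (closure_minimal hsup (g1.isCompact.union r1.isCompact).isClosed).trans (union_subset g2 r2)
  have z3 : ∫ x, ζ x = 0 := by
    rw [integral_sub hgi (hri.const_mul _), integral_const_mul, r3]; ring
  obtain ⟨η, e0, e1, e2, e3⟩ := exists_testFunction_deriv_eq hab z0 z1 z2 z3
  have key := h η e0 e1 e2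
  rw [e3] at key
  have i1 := integrableOn_mul_of_testFunction hk g0.continuous g1
  have i2 := integrableOn_mul_of_testFunction hk r0.continuous r1
  have i3 : IntegrableOn g (Ioo a b) := hgi.integrableOn
  have e4 : ∫ x in Ioo a b, k x * ζ x
      = (∫ x in Ioo a b, k x * g x) - (∫ x, g x) * C := by
    rw [hC, ← integral_const_mul, ← integral_sub i1 (i2.const_mul _)]
    refine integral_congr_ae (.of_forall fun x => ?_)
    simp only [ζ]; ring
  have e5 : ∫ x, g x • (k x - C) = ∫ x in Ioo a b, g x • (k x - C) := by
    refine (setIntegral_eq_integral_of_forall_compl_eq_zero fun x hx => ?_).symm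
    rw [image_eq_zero_of_notMem_tsupport fun h => hx (g2 h), zero_smul]
  have e6 : ∫ x in Ioo a b, g x • (k x - C)
      = (∫ x in Ioo a b, k x * g x) - C * ∫ x in Ioo a b, g x := by
    rw [← integral_const_mul, ← integral_sub i1 (i3.const_mul _)]
    refine integral_congr_ae (.of_forall fun x => ?_)
    simp only [smul_eq_mul]; ring
  rw [e5, e6, setIntegral_Ioo_eq g2]
  linarith

theorem integral_deriv_testFunction {a b : ℝ} {η : ℝ → ℝ}
    (h0 : ContDiff ℝ ∞ η) (h1 : HasCompactSupport η) (h2 : tsupport η ⊆ Ioo a b) :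
    ∫ x in Ioo a b, deriv η x = 0 := by
  rw [setIntegral_Ioo_eq ((closure_minimal (support_deriv_subset) isClosed_closure).trans h2)]
  have h : Continuous (deriv η) := h0.continuous_deriv (by norm_num)
  exact integral_eq_zero_of_hasDerivAt_of_integrable
    (fun x => (h0.differentiable (by norm_num) x).hasDerivAt)
    (h.integrable_of_hasCompactSupport h1.deriv)
    (h0.continuous.integrable_of_hasCompactSupport h1)

/-! ### Description of `H¹₀` by mean-zero derivatives -/

/-- A test pair `(φ, φ')` built from a test function. -/
theorem exists_testPair {φ : ℝ → ℝ} (h0 : ContDiff ℝ ∞ φ) (h1 : HasCompactSupport φ)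
    (h2 : tsupport φ ⊆ Ioo 0 Real.pi) :
    ∃ p ∈ testPairs, p.1 =ᵐ[μI] φ ∧ p.2 =ᵐ[μI] deriv φ := by
  have hd : Continuous (deriv φ) := h0.continuous_deriv (by norm_num)
  have m1 : MemLp φ 2 μI := (h0.continuous.memLp_of_hasCompactSupport h1).restrict _
  have m2 : MemLp (deriv φ) 2 μI := (hd.memLp_of_hasCompactSupport h1.deriv).restrict _
  exact ⟨(m1.toLp φ, m2.toLp _), ⟨φ, h0, h1, h2, m1.coeFn_toLp, m2.coeFn_toLp⟩, m1.coeFn_toLp,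
    m2.coeFn_toLp⟩

theorem testPair_fst_eq_prim {p : L2 × L2} (hp : p ∈ testPairs) : p.1 = prim p.2 := by
  obtain ⟨φ, h0, h1, h2, a1, a2⟩ := hp
  refine Lp.ext ?_
  filter_upwards [a1, toL2_ae (primC p.2), ae_restrict_mem measurableSet_Ioo] with x x1 x2 hx
  change _ = toL2 (primC p.2) x
  rw [x1, x2, val_primC p.2 a2 (Ioo_subset_Icc_self hx),
    intervalIntegral.integral_deriv_eq_sub (fun t _ => (h0.differentiable (by norm_num) t))
      ((h0.continuous_deriv (by norm_num)).intervalIntegrable _ _),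
    image_eq_zero_of_notMem_tsupport (fun h => lt_irrefl _ (h2 h).1 : (0 : ℝ) ∉ tsupport φ),
    sub_zero]

theorem inner_one (f : L2) : inner ℝ one f = ∫ x in Ioo 0 Real.pi, f x := by
  rw [inner_eq]
  refine integral_congr_ae ?_
  filter_upwards [one_ae] with x hx
  rw [hx, one_mul]

theorem inner_one_testPair {p : L2 × L2} (hp : p ∈ testPairs) : inner ℝ one p.2 = 0 := by
  obtain ⟨φ, h0, h1, h2, a1, a2⟩ := hp
  rw [inner_one, integral_congr_ae a2, integral_deriv_testFunction h0 h1 h2]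

theorem fst_eq_prim {p : L2 × L2} (hp : p ∈ H10) : p.1 = prim p.2 :=
  closure_minimal (t := {p : L2 × L2 | p.1 = prim p.2}) (fun _ h => testPair_fst_eq_prim h)
    (isClosed_eq (by fun_prop) (by fun_prop)) hp

theorem inner_one_snd {p : L2 × L2} (hp : p ∈ H10) : inner ℝ one p.2 = 0 :=
  closure_minimal (t := {p : L2 × L2 | inner ℝ one p.2 = 0}) (fun _ h => inner_one_testPair h)
    (isClosed_eq (by fun_prop) (by fun_prop)) hp

/-- The derivatives of the test functions. -/
def testDerivs : Submodule ℝ L2 where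
  carrier := Prod.snd '' testPairs
  zero_mem' := ⟨(0, 0), ⟨0, contDiff_const, HasCompactSupport.zero,
    by simp [tsupport], Lp.coeFn_zero _ _ _, by
      rw [deriv_zero]; exact Lp.coeFn_zero _ _ _⟩, rfl⟩
  add_mem' := by
    rintro _ _ ⟨p, ⟨φ, h0, h1, h2, a1, a2⟩, rfl⟩ ⟨q, ⟨ψ, k0, k1, k2, b1, b2⟩, rfl⟩
    refine ⟨p + q, ⟨φ + ψ, h0.add k0, h1.add k1,
      (tsupport_add φ ψ).trans (union_subset h2 k2), ?_, ?_⟩, rfl⟩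
    · exact (Lp.coeFn_add _ _).trans (a1.add b1)
    · refine (Lp.coeFn_add _ _).trans ((a2.add b2).trans (.of_forall fun x => ?_))
      exact (deriv_add (h0.differentiable (by norm_num) x)
        (k0.differentiable (by norm_num) x)).symm
  smul_mem' := by
    rintro c _ ⟨p, ⟨φ, h0, h1, h2, a1, a2⟩, rfl⟩
    refine ⟨c • p, ⟨c • φ, h0.const_smul c, h1.smul_left (f := fun _ => c),
      (tsupport_smul_subset_right (fun _ => c) φ).trans h2, ?_, ?_⟩, rfl⟩
    · exact (Lp.coeFn_smul _ _).trans (a1.const_smul c)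
    · refine (Lp.coeFn_smul _ _).trans ((a2.const_smul c).trans (.of_forall fun x => ?_))
      exact (deriv_const_smul c (h0.differentiable (by norm_num) x)).symm

theorem exists_smul_one_of_mem_testDerivs_orthogonal {k : L2} (hk : k ∈ testDerivsᗮ) :
    ∃ c : ℝ, k = c • one := by
  obtain ⟨c, hc⟩ := ae_eq_const_of_integral_mul_deriv_eq_zero Real.pi_pos (integrableOn_coe k)
    (fun η h0 h1 h2 => by
      obtain ⟨p, hp, _, a2⟩ := exists_testPair h0 h1 h2
      have h := (Submodule.mem_orthogonal' _ _).1 hk p.2 ⟨p, hp, rfl⟩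
      rw [inner_eq] at h
      refine (integral_congr_ae ?_).trans h
      filter_upwards [a2] with x hx
      rw [hx])
  refine ⟨c, Lp.ext ?_⟩
  filter_upwards [hc, Lp.coeFn_smul c one, one_ae] with x h1 h2 h3
  rw [h1, h2, Pi.smul_apply, h3]; simp

/-- The derivatives of the elements of `H¹₀(0,π)`: the functions with mean zero. -/
def meanZero : Submodule ℝ L2 := (ℝ ∙ one)ᗮ

theorem mem_meanZero {v : L2} : v ∈ meanZero ↔ inner ℝ one v = 0 :=
  Submodule.mem_orthogonal_singleton_iff_inner_right

/-- By du Bois-Reymond only constants are orthogonal to all derivatives of test functions, so the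
double orthogonal complement shows that these derivatives are dense among the mean-zero functions.
-/
theorem prim_mem_H10 {v : L2} (hv : v ∈ meanZero) : (prim v, v) ∈ H10 := by
  have h1 : v ∈ testDerivsᗮᗮ := by
    rw [Submodule.mem_orthogonal]
    intro k hk
    obtain ⟨c, rfl⟩ := exists_smul_one_of_mem_testDerivs_orthogonal hk
    rw [real_inner_smul_left, mem_meanZero.1 hv, mul_zero]
  rw [Submodule.orthogonal_orthogonal_eq_closure] at h1
  have h2 : v ∈ closure (testDerivs : Set L2) := h1
  have hc : Continuous fun v : L2 => (prim v, v) := by fun_prop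
  refine (map_mem_closure hc h2 ?_ : _ ∈ closure testPairs)
  rintro _ ⟨p, hp, rfl⟩
  change (prim p.2, p.2) ∈ testPairs
  rwa [← testPair_fst_eq_prim hp]

theorem mem_H10_iff {p : L2 × L2} : p ∈ H10 ↔ p.1 = prim p.2 ∧ p.2 ∈ meanZero := by
  refine ⟨fun h => ⟨fst_eq_prim h, mem_meanZero.2 (inner_one_snd h)⟩, fun h => ?_⟩
  have := prim_mem_H10 h.2
  rwa [← h.1] at this

/-! ### Integration by parts and the kernel of the form -/

theorem integral_Ioo_eq_interval (f : ℝ → ℝ) :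
    ∫ x in Ioo 0 Real.pi, f x = ∫ x in (0)..Real.pi, f x := by
  rw [intervalIntegral.integral_of_le Real.pi_pos.le, integral_Ioc_eq_integral_Ioo]

theorem hasDerivAt_integral_val (g : C0) (x : ℝ) :
    HasDerivAt (fun x => ∫ t in (0)..x, val g t) (val g x) x :=
  ((continuous_val g).integral_hasStrictDerivAt 0 x).hasDerivAt

/-- Integration by parts against an element of `H¹₀(0,π)`. -/
theorem inner_prim_toL2 (g : C0) {q : L2 × L2} (hq : q ∈ H10) :
    inner ℝ (prim (toL2 g)) q.2 = -inner ℝ (toL2 g) q.1 := by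
  refine closure_minimal
    (t := {q : L2 × L2 | inner ℝ (prim (toL2 g)) q.2 = -inner ℝ (toL2 g) q.1}) ?_
    (isClosed_eq (by fun_prop) (by fun_prop)) hq
  rintro q ⟨φ, h0, h1, h2, a1, a2⟩
  have hφ : Continuous (deriv φ) := h0.continuous_deriv (by norm_num)
  have e1 : inner ℝ (prim (toL2 g)) q.2
      = ∫ x in (0)..Real.pi, (∫ t in (0)..x, val g t) * deriv φ x := by
    rw [inner_eq, ← integral_Ioo_eq_interval]
    refine integral_congr_ae ?_
    filter_upwards [toL2_ae (primC (toL2 g)), a2, ae_restrict_mem measurableSet_Ioo]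
      with x x1 x2 hx
    change toL2 (primC (toL2 g)) x * _ = _
    rw [x1, x2, val_primC _ (toL2_ae g) (Ioo_subset_Icc_self hx)]
  have e2 : inner ℝ (toL2 g) q.1 = ∫ x in (0)..Real.pi, val g x * φ x := by
    rw [inner_eq, ← integral_Ioo_eq_interval]
    refine integral_congr_ae ?_
    filter_upwards [toL2_ae g, a1] with x x1 x2
    rw [x1, x2]
  change inner ℝ (prim (toL2 g)) q.2 = -inner ℝ (toL2 g) q.1
  rw [e1, e2, intervalIntegral.integral_mul_deriv_eq_deriv_mul
    (fun x _ => hasDerivAt_integral_val g x)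
    (fun x _ => (h0.differentiable (by norm_num) x).hasDerivAt)
    ((continuous_val g).intervalIntegrable _ _) (hφ.intervalIntegrable _ _),
    image_eq_zero_of_notMem_tsupport (fun h => lt_irrefl _ (h2 h).2 : Real.pi ∉ tsupport φ)]
  simp

/-- The kernel of the form `J_e` on `H¹₀(0,π)`, described by the derivatives of its elements. -/
def InKernel (e : C0) (v : L2) : Prop := v ∈ meanZero ∧ ∀ q ∈ H10, J e (prim v, v) q = 0

/-- This is the equation `u'' + (1 + e) u = 0` integrated once, for `u = prim v`; the constant plays
the role of `u'(0)`. -/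
theorem InKernel.exists_eq {e : C0} {v : L2} (hv : InKernel e v) :
    ∃ c : ℝ, v + prim (toL2 ((1 + e) * primC v)) = c • one := by
  refine exists_smul_one_of_mem_testDerivs_orthogonal ?_
  rw [Submodule.mem_orthogonal']
  rintro _ ⟨q, hq, rfl⟩
  have hq' : q ∈ H10 := subset_closure hq
  have h1 := hv.2 q hq'
  rw [J_eq] at h1
  have h2 : toL2 ((1 + e) * primC v) = prim v + mulOp e (prim v) := by
    rw [add_mul, one_mul, map_add, ← mulOp_toL2]; rfl
  rw [inner_add_left, inner_prim_toL2 _ hq', h2, inner_add_left]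
  linarith

/-- Uniqueness for the Cauchy problem with `u(0) = u'(0) = 0`, by Gronwall for the first-order
system satisfied by `F = (u, -u')`. -/
theorem InKernel.eq_zero {e : C0} {v : L2} (hv : v + prim (toL2 ((1 + e) * primC v)) = 0) :
    v = 0 := by
  set h : C0 := (1 + e) * primC v with hh
  set Z : C0 := -primC (toL2 h) with hZ
  have hvZ : v = toL2 Z := by
    rw [hZ, map_neg]; exact eq_neg_of_add_eq_zero_left hv
  let F : ℝ → ℝ × ℝ := fun x => (∫ t in (0)..x, val Z t, ∫ t in (0)..x, val h t)
  have hF : ∀ x, HasDerivAt F (val Z x, val h x) x := fun x =>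
    (hasDerivAt_integral_val Z x).prodMk (hasDerivAt_integral_val h x)
  have hF1 : ∀ x ∈ Icc 0 Real.pi, val (primC v) x = (F x).1 := fun x hx =>
    val_primC v (hvZ ▸ toL2_ae Z) hx
  have hF2 : ∀ x ∈ Icc 0 Real.pi, val Z x = -(F x).2 := fun x hx => by
    rw [hZ]
    change -val (primC (toL2 h)) x = _
    rw [val_primC _ (toL2_ae h) hx]
  have hzero : ∀ x ∈ Icc 0 Real.pi, F x = 0 := by
    refine eq_zero_of_abs_deriv_le_mul_abs_self_of_eq_zero_right (K := 1 + ‖e‖)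
      (fun x _ => (hF x).continuousAt.continuousWithinAt)
      (fun x _ => (hF x).hasDerivWithinAt) (by simp [F]) ?_
    intro x hx
    have hx' := Ico_subset_Icc_self hx
    rw [hF2 x hx', hh, val_mul, hF1 x hx', norm_prod_le_iff]
    have n1 := norm_fst_le (F x)
    have n2 := norm_snd_le (F x)
    constructor
    · change ‖-(F x).2‖ ≤ _
      rw [norm_neg]
      nlinarith [norm_nonneg e, norm_nonneg (F x)]
    · change ‖val (1 + e) x * (F x).1‖ ≤ _
      rw [norm_mul]
      refine mul_le_mul ?_ n1 (norm_nonneg _) (by positivity)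
      rw [val_add]
      refine (norm_add_le _ _).trans (add_le_add ?_ (abs_val_le e x))
      change ‖(1 : ℝ)‖ ≤ 1
      simp
  have hW : primC v = 0 := by
    ext x
    have := hF1 x x.2
    rw [val_of_mem _ x.2, hzero x x.2] at this
    exact this
  rw [hvZ, hZ, hh, hW]
  simp

/-- Any two elements of the kernel are proportional. -/
theorem InKernel.exists_smul_eq {e : C0} {v w : L2} (hv : InKernel e v) (hw : InKernel e w)
    (hv0 : v ≠ 0) : ∃ c : ℝ, w = c • v := by
  obtain ⟨a, ha⟩ := hv.exists_eq
  obtain ⟨b, hb⟩ := hw.exists_eq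
  have ha0 : a ≠ 0 := by
    rintro rfl
    exact hv0 (InKernel.eq_zero (by rw [ha, zero_smul]))
  -- With this factor the integration constants of `w` and `(b / a) • v` agree, so the difference
  -- has zero Cauchy data.
  refine ⟨b / a, ?_⟩
  rw [← sub_eq_zero]
  refine InKernel.eq_zero (e := e) ?_
  have h1 : (1 + e) * primC (w - (b / a) • v)
      = (1 + e) * primC w - (b / a) • ((1 + e) * primC v) := by
    rw [map_sub, map_smul, mul_sub, mul_smul_comm]
  rw [h1, map_sub, map_sub, map_smul, map_smul]
  calc _ = (w + prim (toL2 ((1 + e) * primC w)))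
        - (b / a) • (v + prim (toL2 ((1 + e) * primC v))) := by rw [smul_add]; abel
    _ = 0 := by rw [ha, hb, smul_smul, div_mul_cancel₀ _ ha0, sub_self]

/-! ### The potential zero and Wirtinger's inequality -/

/-- The function `sin` on `[0,π]`. -/
def sinC : C0 := ⟨fun x => Real.sin x, by fun_prop⟩

/-- The function `cos` on `[0,π]`. -/
def cosC : C0 := ⟨fun x => Real.cos x, by fun_prop⟩

theorem val_sinC {x : ℝ} (hx : x ∈ Icc 0 Real.pi) : val sinC x = Real.sin x := val_of_mem _ hx

theorem val_cosC {x : ℝ} (hx : x ∈ Icc 0 Real.pi) : val cosC x = Real.cos x := val_of_mem _ hx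

/-- The function `sin` in `L²(0,π)`. -/
def sinL : L2 := toL2 sinC

/-- The function `cos` in `L²(0,π)`. -/
def cosL : L2 := toL2 cosC

theorem sinL_ae : sinL =ᵐ[μI] Real.sin := by
  filter_upwards [toL2_ae sinC, ae_restrict_mem measurableSet_Ioo] with x h1 h2
  exact h1.trans (val_sinC (Ioo_subset_Icc_self h2))

theorem cosL_ae : cosL =ᵐ[μI] Real.cos := by
  filter_upwards [toL2_ae cosC, ae_restrict_mem measurableSet_Ioo] with x h1 h2
  exact h1.trans (val_cosC (Ioo_subset_Icc_self h2))

theorem primC_cosL : primC cosL = sinC := by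
  ext x
  rw [← val_of_mem _ x.2, val_primC _ cosL_ae x.2, integral_cos, Real.sin_zero, sub_zero]
  rfl

theorem primC_sinL : primC sinL = 1 - cosC := by
  ext x
  rw [← val_of_mem _ x.2, val_primC _ sinL_ae x.2, integral_sin, Real.cos_zero]
  rfl

theorem prim_cosL : prim cosL = sinL := congrArg toL2 primC_cosL

theorem toL2_one : toL2 1 = one := by
  refine Lp.ext ?_
  filter_upwards [toL2_ae 1, one_ae] with x h1 h2
  rw [h1, h2]; rfl

theorem cosL_mem_meanZero : cosL ∈ meanZero := by
  rw [mem_meanZero, inner_one, integral_congr_ae cosL_ae, integral_Ioo_eq_interval, integral_cos]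
  simp

theorem inner_cosL {q : L2 × L2} (hq : q ∈ H10) : inner ℝ cosL q.2 = inner ℝ sinL q.1 := by
  have h : prim sinL = one - cosL := by
    change toL2 (primC sinL) = _
    rw [primC_sinL, map_sub, toL2_one]; rfl
  have := inner_prim_toL2 sinC hq
  change inner ℝ (prim sinL) q.2 = -inner ℝ sinL q.1 at this
  rw [h, inner_sub_left, inner_one_snd hq] at this
  linarith

theorem inKernel_cosL : InKernel 0 cosL := by
  refine ⟨cosL_mem_meanZero, fun q hq => ?_⟩
  rw [J_eq, prim_cosL, inner_cosL hq]
  simp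

theorem sinL_ne_zero : sinL ≠ 0 := by
  intro h
  have h1 := sinL_ae
  rw [h] at h1
  have h2 : (fun _ => (0 : ℝ)) =ᵐ[volume.restrict (Icc 0 Real.pi)] Real.sin := by
    rw [← restrict_Ioo_eq_restrict_Icc]
    exact (Lp.coeFn_zero ℝ 2 μI).symm.trans h1
  have h3 := Measure.eqOn_Icc_of_ae_eq volume Real.pi_pos.ne h2 continuousOn_const
    Real.continuous_sin.continuousOn (x := Real.pi / 2)
    ⟨by linarith [Real.pi_pos], by linarith [Real.pi_pos]⟩
  simp at h3

/-- Jacobi's identity `φ'² - φ² = (φ' - φ cot x)² + (φ² cot x)'`. The last term integrates to zero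
because `φ` vanishes near the endpoints, where `cot` is singular. -/
theorem integral_sq_le_integral_deriv_sq {φ : ℝ → ℝ} (h0 : ContDiff ℝ ∞ φ)
    (h1 : HasCompactSupport φ) (h2 : tsupport φ ⊆ Ioo 0 Real.pi) :
    ∫ x, φ x * φ x ≤ ∫ x, deriv φ x * deriv φ x := by
  obtain ⟨c, d, hc, hcd, hd, hs⟩ := exists_tsupport_subset_Icc Real.pi_pos h1 h2
  have hsub : Icc (c / 2) ((d + Real.pi) / 2) ⊆ Ioo 0 Real.pi :=
    Icc_subset_Ioo (by linarith) (by linarith)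
  -- The midpoints leave room on both sides: `sin` does not vanish on `[a, b]`, and `φ` vanishes at
  -- `a` and `b`.
  set a := c / 2
  set b := (d + Real.pi) / 2
  have hab : a ≤ b := by simp only [a, b]; linarith
  have hφ : Continuous (deriv φ) := h0.continuous_deriv (by norm_num)
  have hsupp : ∀ f : ℝ → ℝ, (∀ x, x ∉ tsupport φ → f x = 0) → ∫ x, f x = ∫ x in a..b, f x := by
    intro f hf
    refine (intervalIntegral.integral_eq_integral_of_support_subset fun x hx => ?_).symm
    have hx' : x ∈ tsupport φ := by by_contra h; exact hx (hf x h)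
    have := hs hx'
    exact ⟨by simp only [a]; linarith [this.1], by simp only [b]; linarith [this.2]⟩
  have hz : ∀ x, x ∉ tsupport φ → φ x = 0 := fun x => image_eq_zero_of_notMem_tsupport
  have hz' : ∀ x, x ∉ tsupport φ → deriv φ x = 0 := fun x hx => by
    by_contra h; exact hx (support_deriv_subset h)
  rw [hsupp _ (fun x hx => by rw [hz x hx, zero_mul]),
    hsupp _ (fun x hx => by rw [hz' x hx, zero_mul])]
  have hsin : ∀ x ∈ uIcc a b, Real.sin x ≠ 0 := fun x hx => by
    rw [uIcc_of_le hab] at hx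
    exact (Real.sin_pos_of_mem_Ioo (hsub hx)).ne'
  let g : ℝ → ℝ := fun x => φ x * φ x * (Real.cos x / Real.sin x)
  let g' : ℝ → ℝ := fun x => (deriv φ x * φ x + φ x * deriv φ x) * (Real.cos x / Real.sin x)
    + φ x * φ x * ((-Real.sin x * Real.sin x - Real.cos x * Real.cos x) / Real.sin x ^ 2)
  have hg : ∀ x ∈ uIcc a b, HasDerivAt g (g' x) x := fun x hx => by
    have hd := (h0.differentiable (by norm_num) x).hasDerivAt
    exact (hd.mul hd).mul ((Real.hasDerivAt_cos x).div (Real.hasDerivAt_sin x) (hsin x hx))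
  have hcs : ContinuousOn Real.sin (uIcc a b) := Real.continuous_sin.continuousOn
  have hcc : ContinuousOn Real.cos (uIcc a b) := Real.continuous_cos.continuousOn
  have hcφ : ContinuousOn φ (uIcc a b) := h0.continuous.continuousOn
  have hcφ' : ContinuousOn (deriv φ) (uIcc a b) := hφ.continuousOn
  have hg'c : ContinuousOn g' (uIcc a b) :=
    (((hcφ'.mul hcφ).add (hcφ.mul hcφ')).mul (hcc.div hcs hsin)).add
      ((hcφ.mul hcφ).mul (((hcs.neg.mul hcs).sub (hcc.mul hcc)).div (hcs.pow 2)
        fun x hx => pow_ne_zero 2 (hsin x hx)))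
  have hint := intervalIntegral.integral_eq_sub_of_hasDerivAt hg hg'c.intervalIntegrable
  have hga : g a = 0 := by
    have : a ∉ tsupport φ := fun h => by have := (hs h).1; simp only [a] at this; linarith
    simp [g, hz a this]
  have hgb : g b = 0 := by
    have : b ∉ tsupport φ := fun h => by have := (hs h).2; simp only [b] at this; linarith
    simp [g, hz b this]
  rw [hga, hgb, sub_zero] at hint
  have i1 : IntervalIntegrable (fun x => φ x * φ x) volume a b :=
    (h0.continuous.mul h0.continuous).intervalIntegrable _ _
  have i2 : IntervalIntegrable (fun x => deriv φ x * deriv φ x) volume a b :=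
    (hφ.mul hφ).intervalIntegrable _ _
  have hle : ∫ x in a..b, (φ x * φ x + g' x) ≤ ∫ x in a..b, deriv φ x * deriv φ x := by
    refine intervalIntegral.integral_mono_on hab (i1.add hg'c.intervalIntegrable) i2 ?_
    intro x hx
    have hs' := hsin x (by rwa [uIcc_of_le hab])
    have e1 : (-Real.sin x * Real.sin x - Real.cos x * Real.cos x) / Real.sin x ^ 2
        = -1 - (Real.cos x / Real.sin x) ^ 2 := by
      field_simp
    simp only [g', e1]
    nlinarith [sq_nonneg (deriv φ x - φ x * (Real.cos x / Real.sin x))]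
  rw [intervalIntegral.integral_add i1 hg'c.intervalIntegrable, hint, add_zero] at hle
  exact hle

/-- Wirtinger's inequality. -/
theorem norm_fst_le_norm_snd {p : L2 × L2} (hp : p ∈ H10) : ‖p.1‖ ≤ ‖p.2‖ := by
  refine closure_minimal (t := {p : L2 × L2 | ‖p.1‖ ≤ ‖p.2‖}) ?_
    (isClosed_le (by fun_prop) (by fun_prop)) hp
  rintro p ⟨φ, h0, h1, h2, a1, a2⟩
  have hs : ∀ f : ℝ → ℝ, (∀ x, x ∉ tsupport φ → f x = 0) →
      ∫ x in Ioo 0 Real.pi, f x = ∫ x, f x := fun f hf =>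
    setIntegral_eq_integral_of_forall_compl_eq_zero fun x hx => hf x fun h => hx (h2 h)
  change ‖p.1‖ ≤ ‖p.2‖
  refine abs_le_of_sq_le_sq' ?_ (norm_nonneg _) |>.2
  rw [← real_inner_self_eq_norm_sq, ← real_inner_self_eq_norm_sq, inner_eq, inner_eq]
  have e1 : ∫ x in Ioo 0 Real.pi, p.1 x * p.1 x = ∫ x, φ x * φ x := by
    rw [← hs _ fun x hx => by rw [image_eq_zero_of_notMem_tsupport hx, zero_mul]]
    refine integral_congr_ae ?_
    filter_upwards [a1] with x hx
    rw [hx]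
  have e2 : ∫ x in Ioo 0 Real.pi, p.2 x * p.2 x = ∫ x, deriv φ x * deriv φ x := by
    rw [← hs _ fun x hx => by
      rw [show deriv φ x = 0 by by_contra h; exact hx (support_deriv_subset h), zero_mul]]
    refine integral_congr_ae ?_
    filter_upwards [a2] with x hx
    rw [hx]
  rw [e1, e2]
  exact integral_sq_le_integral_deriv_sq h0 h1 h2

/-! ### Fredholm alternative and weak solvability -/

/-- The Fredholm alternative for `1 - B`, with `B` compact and symmetric. -/
theorem exists_sub_apply_eq_of_orthogonal {E : Type*} [NormedAddCommGroup E]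
    [InnerProductSpace ℝ E] [CompleteSpace E] {B : E →L[ℝ] E} (hc : IsCompactOperator B)
    (hs : (B : E →ₗ[ℝ] E).IsSymmetric) {g : E} (hg : ∀ x, B x = x → inner ℝ x g = 0) :
    ∃ x, x - B x = g := by
  let N : Submodule ℝ E := LinearMap.ker ((1 - B : E →L[ℝ] E) : E →ₗ[ℝ] E)
  have hN : ∀ x, x ∈ N ↔ B x = x := fun x => by
    simp only [N, LinearMap.mem_ker, ContinuousLinearMap.coe_coe, sub_apply,
      one_apply_eq_self, sub_eq_zero]
    exact eq_comm
  have hinv : ∀ x ∈ Nᗮ, B x ∈ Nᗮ := fun x hx => by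
    rw [Submodule.mem_orthogonal] at hx ⊢
    intro u hu
    have h1 : inner ℝ (B u) x = inner ℝ u (B x) := hs u x
    rw [← h1, (hN u).1 hu, hx u hu]
  -- By symmetry `B` preserves the complement of its fixed space. There 1 is no longer an
  -- eigenvalue, so compactness makes `1 - B` invertible.
  let S : Nᗮ →L[ℝ] Nᗮ := B.restrict hinv
  have hS : IsCompactOperator S :=
    IsCompactOperator.restrict' (f := (B : E →ₗ[ℝ] E)) hc hinv
  rcases hS.hasEigenvalue_or_mem_resolventSet (one_ne_zero (α := ℝ)) with h | h
  · exfalso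
    obtain ⟨x, hx⟩ := h.exists_hasEigenvector
    have h1 : S x = x := by simpa using hx.apply_eq_smul
    have h2 : (x : E) ∈ N := (hN _).2 (congrArg Subtype.val h1)
    have h3 : inner ℝ (x : E) (x : E) = 0 := (Submodule.mem_orthogonal _ _).1 x.2 _ h2
    exact hx.2 (Subtype.ext (inner_self_eq_zero.1 h3))
  · have hg' : g ∈ Nᗮ := by
      rw [Submodule.mem_orthogonal]
      exact fun x hx => hg x ((hN x).1 hx)
    rw [spectrum.mem_resolventSet_iff, map_one] at h
    obtain ⟨R, hR⟩ := h.exists_right_inv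
    refine ⟨(R ⟨g, hg'⟩ : E), ?_⟩
    have := congrArg Subtype.val (DFunLike.congr_fun hR ⟨g, hg'⟩)
    exact this

theorem add_mem_H10 {p q : L2 × L2} (hp : p ∈ H10) (hq : q ∈ H10) : p + q ∈ H10 := by
  rw [mem_H10_iff] at *
  exact ⟨by rw [Prod.fst_add, Prod.snd_add, map_add, hp.1, hq.1], add_mem hp.2 hq.2⟩

theorem smul_mem_H10 {p : L2 × L2} (c : ℝ) (hp : p ∈ H10) : c • p ∈ H10 := by
  rw [mem_H10_iff] at *
  exact ⟨by rw [Prod.smul_fst, Prod.smul_snd, map_smul, hp.1], Submodule.smul_mem _ c hp.2⟩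

theorem J_comm (e : C0) (p q : L2 × L2) : J e p q = J e q p := by
  rw [J_eq, J_eq, inner_mulOp_comm, real_inner_comm q.2, real_inner_comm q.1,
    real_inner_comm (mulOp e q.1)]

theorem J_add_left (e : C0) (p q r : L2 × L2) : J e (p + q) r = J e p r + J e q r := by
  simp only [J_eq, Prod.fst_add, Prod.snd_add, map_add, inner_add_left]
  ring

theorem J_smul_left (e : C0) (c : ℝ) (p q : L2 × L2) : J e (c • p) q = c * J e p q := by
  simp only [J_eq, Prod.smul_fst, Prod.smul_snd, map_smul, real_inner_smul_left]
  ring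

theorem J_add_right (e : C0) (p q r : L2 × L2) : J e p (q + r) = J e p q + J e p r := by
  rw [J_comm, J_add_left, J_comm e q, J_comm e r]

theorem J_smul_right (e : C0) (c : ℝ) (p q : L2 × L2) : J e p (c • q) = c * J e p q := by
  rw [J_comm, J_smul_left, J_comm]

theorem continuous_J_self (e : C0) : Continuous fun p : L2 × L2 => J e p p := by
  simp only [J_eq]
  fun_prop

/-- If `f` is orthogonal to the kernel of `J_e`, then `L_e w = f` has a weak solution. -/
theorem exists_forall_J_eq {e : C0} {f : L2}
    (hf : ∀ v, InKernel e v → inner ℝ f (prim v) = 0) :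
    ∃ p ∈ H10, ∀ q ∈ H10, J e p q = inner ℝ f q.1 := by
  have : CompleteSpace meanZero := inferInstanceAs (CompleteSpace (ℝ ∙ one)ᗮ)
  let S : meanZero →L[ℝ] L2 := prim.comp meanZero.subtypeL
  have hSc : IsCompactOperator S := isCompactOperator_prim.comp_clm _
  -- Chosen so that `J e` becomes the form of `1 - B` in the derivative coordinate; fixed vectors of
  -- `B` are then exactly kernel elements of `J e`.
  let B : meanZero →L[ℝ] meanZero := (S.adjoint.comp (mulOp (1 + e))).comp S
  have hB : ∀ v w : meanZero, inner ℝ (B v) w = inner ℝ (mulOp (1 + e) (S v)) (S w) :=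
    fun v w => ContinuousLinearMap.adjoint_inner_left S w _
  have hBc : IsCompactOperator B :=
    hSc.clm_comp (S.adjoint.comp (mulOp (1 + e)))
  have hBs : (B : meanZero →ₗ[ℝ] meanZero).IsSymmetric := fun v w => by
    change inner ℝ (B v) w = inner ℝ v (B w)
    rw [hB, real_inner_comm (B w), hB, inner_mulOp_comm, real_inner_comm]
  have hmul : ∀ u, mulOp (1 + e) u = u + mulOp e u := fun u => by
    have h1 : (1 : C0) = ContinuousMap.const _ 1 := rfl
    rw [map_add, add_apply, h1, mulOp_const, one_smul]
  have hJ : ∀ v w : meanZero,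
      J e (prim v, (v : L2)) (prim w, (w : L2)) = inner ℝ (v - B v) w := fun v w => by
    rw [inner_sub_left, hB, hmul, inner_add_left, J_eq, sub_sub]
    rfl
  obtain ⟨v, hv⟩ := exists_sub_apply_eq_of_orthogonal hBc hBs (g := S.adjoint f) (fun x hx => by
    rw [ContinuousLinearMap.adjoint_inner_right, real_inner_comm]
    refine hf x ⟨x.2, fun q hq => ?_⟩
    obtain ⟨h1, h2⟩ := mem_H10_iff.1 hq
    have h3 := hJ x ⟨q.2, h2⟩
    rw [hx, sub_self, inner_zero_left] at h3
    change J e _ (prim q.2, q.2) = 0 at h3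
    rwa [← h1] at h3)
  refine ⟨(prim v, v), prim_mem_H10 v.2, fun q hq => ?_⟩
  obtain ⟨h1, h2⟩ := mem_H10_iff.1 hq
  have h3 := hJ v ⟨q.2, h2⟩
  rw [hv, ContinuousLinearMap.adjoint_inner_left] at h3
  change J e _ (prim q.2, q.2) = inner ℝ f (prim q.2) at h3
  rwa [← h1] at h3

/-! ### Rayleigh quotient and first eigenvalue -/

theorem abs_inner_mulOp_le (e : C0) (u : L2) : |inner ℝ (mulOp e u) u| ≤ ‖e‖ * ‖u‖ ^ 2 := by
  refine (abs_real_inner_le_norm _ _).trans ?_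
  rw [sq, ← mul_assoc]
  exact mul_le_mul_of_nonneg_right (norm_mulOp_apply_le e u) (norm_nonneg _)

theorem J_self_eq (e : C0) (p : L2 × L2) :
    J e p p = ‖p.2‖ ^ 2 - ‖p.1‖ ^ 2 - inner ℝ (mulOp e p.1) p.1 := by
  rw [J_eq, real_inner_self_eq_norm_sq, real_inner_self_eq_norm_sq]

theorem neg_norm_mul_le_J (e : C0) {p : L2 × L2} (hp : p ∈ H10) :
    -(‖e‖ * ‖p.1‖ ^ 2) ≤ J e p p := by
  have h1 := pow_le_pow_left₀ (norm_nonneg _) (norm_fst_le_norm_snd hp) 2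
  have h2 := abs_le.1 (abs_inner_mulOp_le e p.1)
  rw [J_self_eq]
  linarith [h2.2]

theorem bddBelow_rayleighValues (e : C0) : BddBelow (rayleighValues e) := by
  refine ⟨-‖e‖, ?_⟩
  rintro r ⟨p, hp, h1, rfl⟩
  have := neg_norm_mul_le_J e hp
  rwa [h1, one_pow, mul_one] at this

theorem mem_rayleighValues_div {e : C0} {p : L2 × L2} (hp : p ∈ H10) (h0 : p.1 ≠ 0) :
    J e p p / ‖p.1‖ ^ 2 ∈ rayleighValues e := by
  refine ⟨‖p.1‖⁻¹ • p, smul_mem_H10 _ hp, ?_, ?_⟩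
  · rw [Prod.smul_fst, norm_smul, norm_inv, norm_norm, inv_mul_cancel₀ (norm_ne_zero_iff.2 h0)]
  · rw [J_smul_left, J_smul_right]
    field_simp

theorem sInf_rayleighValues_mul_le (e : C0) {p : L2 × L2} (hp : p ∈ H10) :
    sInf (rayleighValues e) * ‖p.1‖ ^ 2 ≤ J e p p := by
  by_cases h0 : p.1 = 0
  · have := neg_norm_mul_le_J e hp
    rw [h0, norm_zero] at this ⊢
    linarith
  · have := csInf_le (bddBelow_rayleighValues e) (mem_rayleighValues_div hp h0)
    rwa [le_div_iff₀ (by positivity)] at this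

theorem sin_mem_H10 : (sinL, cosL) ∈ H10 :=
  mem_H10_iff.2 ⟨prim_cosL.symm, cosL_mem_meanZero⟩

theorem rayleighValues_nonempty (e : C0) : (rayleighValues e).Nonempty :=
  ⟨_, mem_rayleighValues_div sin_mem_H10 sinL_ne_zero⟩

/-- The parallelogram estimate that makes minimizing sequences Cauchy. -/
theorem norm_snd_sub_sq_le (e : C0) {p q : L2 × L2} (hp : p ∈ H10) (hq : q ∈ H10)
    (hp1 : ‖p.1‖ = 1) (hq1 : ‖q.1‖ = 1) :
    ‖p.2 - q.2‖ ^ 2 ≤ 2 * (J e p p - sInf (rayleighValues e))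
      + 2 * (J e q q - sInf (rayleighValues e))
      + (1 + ‖e‖ + |sInf (rayleighValues e)|) * ‖p.1 - q.1‖ ^ 2 := by
  set m := sInf (rayleighValues e)
  have hadd := sInf_rayleighValues_mul_le e (add_mem_H10 hp hq)
  have hpar := parallelogram_law_with_norm ℝ p.1 q.1
  rw [hp1, hq1] at hpar
  -- Parallelogram law for the quadratic form `J e`. Bounding `J e` at `p + q` below by the infimum
  -- bounds it above at `p - q`.
  have hsub : J e (p + (-1 : ℝ) • q) (p + (-1 : ℝ) • q) + J e (p + q) (p + q)
      = 2 * J e p p + 2 * J e q q := by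
    simp only [J_add_left, J_add_right, J_smul_left, J_smul_right]
    ring
  have hself := J_self_eq e (p + (-1 : ℝ) • q)
  have hb := (abs_le.1 (abs_inner_mulOp_le e (p + (-1 : ℝ) • q).1)).2
  have e1 : (p + (-1 : ℝ) • q).1 = p.1 - q.1 := by simp [sub_eq_add_neg]
  have e2 : (p + (-1 : ℝ) • q).2 = p.2 - q.2 := by simp [sub_eq_add_neg]
  rw [e1] at hb
  rw [e1, e2] at hself
  change m * ‖p.1 + q.1‖ ^ 2 ≤ _ at hadd
  have h4 : ‖p.1 + q.1‖ ^ 2 = 4 - ‖p.1 - q.1‖ ^ 2 := by nlinarith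
  rw [h4] at hadd
  have h5 : m * ‖p.1 - q.1‖ ^ 2 ≤ |m| * ‖p.1 - q.1‖ ^ 2 :=
    mul_le_mul_of_nonneg_right (le_abs_self m) (sq_nonneg _)
  linarith

/-- The minimum of the Rayleigh quotient is attained. -/
theorem exists_minimizer (e : C0) :
    ∃ p ∈ H10, ‖p.1‖ = 1 ∧ J e p p = sInf (rayleighValues e) := by
  obtain ⟨r, -, hr, hmem⟩ := exists_seq_tendsto_sInf (rayleighValues_nonempty e)
    (bddBelow_rayleighValues e)
  set m := sInf (rayleighValues e) with hm
  choose p hp hp1 hrp using hmem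
  obtain ⟨R, hR⟩ := hr.bddAbove_range
  -- `J_self_eq` bounds the square of the norm by `R + 1 + ‖e‖`; the last `+ 1` gives a bound on the
  -- norm itself, since `x² ≤ S` implies `x ≤ S + 1`.
  have hbd : ∀ n, (p n).2 ∈ Metric.closedBall (0 : L2) (R + 1 + ‖e‖ + 1) := fun n => by
    have h1 := J_self_eq e (p n)
    have h2 := (abs_le.1 (abs_inner_mulOp_le e (p n).1)).2
    have h3 : r n ≤ R := hR ⟨n, rfl⟩
    rw [← hrp, hp1] at h1
    rw [hp1] at h2
    rw [mem_closedBall_zero_iff]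
    nlinarith [norm_nonneg (p n).2]
  obtain ⟨K, hK, hsub⟩ := IsCompactOperator.image_closedBall_subset_compact
    (f := (prim : L2 →ₗ[ℝ] L2)) isCompactOperator_prim (R + 1 + ‖e‖ + 1)
  obtain ⟨u, -, φ, hφ, hu⟩ := hK.tendsto_subseq (x := fun n => (p n).1) fun n => by
    rw [fst_eq_prim (hp n)]
    exact hsub ⟨_, hbd n, rfl⟩
  set C := 1 + ‖e‖ + |m| with hC
  have hC0 : 0 ≤ C := by positivity
  let s : ℕ → ℝ := fun k => 2 * (r (φ k) - m) + 2 * C * ‖(p (φ k)).1 - u‖ ^ 2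
  have hs : Tendsto s atTop (𝓝 0) := by
    have h1 : Tendsto (fun k => r (φ k)) atTop (𝓝 m) := hr.comp hφ.tendsto_atTop
    have h2 : Tendsto (fun k => ‖(p (φ k)).1 - u‖) atTop (𝓝 0) :=
      tendsto_iff_norm_sub_tendsto_zero.1 hu
    have := ((h1.sub_const m).const_mul 2).add ((h2.pow 2).const_mul (2 * C))
    simpa [s] using this
  have hle : ∀ k l, ‖(p (φ k)).2 - (p (φ l)).2‖ ^ 2 ≤ s k + s l := fun k l => by
    have h1 := norm_snd_sub_sq_le e (hp (φ k)) (hp (φ l)) (hp1 _) (hp1 _)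
    rw [← hrp, ← hrp, ← hm, ← hC] at h1
    have h2 : ‖(p (φ k)).1 - (p (φ l)).1‖ ≤ ‖(p (φ k)).1 - u‖ + ‖(p (φ l)).1 - u‖ := by
      rw [norm_sub_rev (p (φ l)).1]; exact norm_sub_le_norm_sub_add_norm_sub _ _ _
    have h3 : ‖(p (φ k)).1 - (p (φ l)).1‖ ^ 2
        ≤ 2 * ‖(p (φ k)).1 - u‖ ^ 2 + 2 * ‖(p (φ l)).1 - u‖ ^ 2 := by
      nlinarith [norm_nonneg ((p (φ k)).1 - (p (φ l)).1),
        sq_nonneg (‖(p (φ k)).1 - u‖ - ‖(p (φ l)).1 - u‖)]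
    have h4 := mul_le_mul_of_nonneg_left h3 hC0
    simp only [s]
    linarith
  have hcauchy : CauchySeq fun k => (p (φ k)).2 := by
    rw [Metric.cauchySeq_iff]
    intro ε hε
    obtain ⟨N, hN⟩ := eventually_atTop.1 (hs.eventually (gt_mem_nhds (by positivity :
      0 < ε ^ 2 / 2)))
    refine ⟨N, fun k hk l hl => ?_⟩
    rw [dist_eq_norm]
    refine lt_of_pow_lt_pow_left₀ 2 hε.le ?_
    linarith [hle k l, hN k hk, hN l hl]
  obtain ⟨v, hv⟩ := cauchySeq_tendsto_of_complete hcauchy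
  have hlim : Tendsto (fun k => p (φ k)) atTop (𝓝 (u, v)) := by
    have := hu.prodMk_nhds hv
    exact this
  refine ⟨(u, v), isClosed_closure.mem_of_tendsto hlim (.of_forall fun k => hp _), ?_, ?_⟩
  · refine tendsto_nhds_unique hu.norm ?_
    simp [hp1]
  · refine tendsto_nhds_unique (((continuous_J_self e).tendsto (u, v)).comp hlim) ?_
    refine (hr.comp hφ.tendsto_atTop).congr fun k => ?_
    exact hrp _

/-- A minimizer of the Rayleigh quotient is an eigenfunction. -/
theorem J_eq_of_minimizer {e : C0} {p : L2 × L2} (hp : p ∈ H10) (hp1 : ‖p.1‖ = 1)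
    (hm : J e p p = sInf (rayleighValues e)) {q : L2 × L2} (hq : q ∈ H10) :
    J e p q = sInf (rayleighValues e) * inner ℝ p.1 q.1 := by
  set m := sInf (rayleighValues e)
  -- Minimality along `p + t q` gives a nonnegative quadratic in `t` without constant term, so its
  -- discriminant forces the linear coefficient to vanish.
  have key : ∀ t : ℝ, 0 ≤ (J e q q - m * ‖q.1‖ ^ 2) * (t * t)
      + (2 * (J e p q - m * inner ℝ p.1 q.1)) * t + 0 := fun t => by
    have h := sInf_rayleighValues_mul_le e (add_mem_H10 hp (smul_mem_H10 t hq))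
    change m * ‖p.1 + t • q.1‖ ^ 2 ≤ _ at h
    rw [norm_add_sq_real, real_inner_smul_right, norm_smul, hp1] at h
    simp only [J_add_left, J_add_right, J_smul_left, J_smul_right] at h
    rw [J_comm e q p, hm, mul_pow, Real.norm_eq_abs, sq_abs] at h
    linarith
  have := discrim_le_zero key
  rw [discrim] at this
  nlinarith [sq_nonneg (J e p q - m * inner ℝ p.1 q.1)]

theorem isLeast_rayleighValues (e : C0) :
    IsLeast (rayleighValues e) (sInf (rayleighValues e)) := by
  obtain ⟨p, hp, hp1, hm⟩ := exists_minimizer e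
  exact ⟨⟨p, hp, hp1, hm.symm⟩, fun r hr => csInf_le (bddBelow_rayleighValues e) hr⟩

/-- A minimizer satisfies the Euler–Lagrange equation; testing any eigenfunction with itself shows
that its eigenvalue is a Rayleigh value. -/
theorem isLeast_eigenvalues (e : C0) : IsLeast (eigenvalues e) (sInf (rayleighValues e)) := by
  constructor
  · obtain ⟨p, hp, hp1, hm⟩ := exists_minimizer e
    refine ⟨p.1, fun h => by simp [h] at hp1, p.2, hp, fun q hq => ?_⟩
    rw [pairing_eq]
    exact J_eq_of_minimizer hp hp1 hm hq
  · rintro r ⟨u, hu, ux, hux, h⟩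
    have h1 := csInf_le (bddBelow_rayleighValues e) (mem_rayleighValues_div hux hu)
    rwa [h _ hux, pairing_eq, real_inner_self_eq_norm_sq,
      mul_div_cancel_right₀ _ (by simpa using hu)] at h1

theorem firstEigenvalue_eq (e : C0) : firstEigenvalue e = sInf (rayleighValues e) :=
  (isLeast_eigenvalues e).csInf_eq

theorem abs_firstEigenvalue_le (e : C0) : |firstEigenvalue e| ≤ ‖e‖ := by
  rw [firstEigenvalue_eq, abs_le]
  constructor
  · refine le_csInf (rayleighValues_nonempty e) ?_
    rintro r ⟨p, hp, h1, rfl⟩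
    have := neg_norm_mul_le_J e hp
    rwa [h1, one_pow, mul_one] at this
  · have h0 : 0 < ‖sinL‖ := norm_pos_iff.2 sinL_ne_zero
    have h1 := sInf_rayleighValues_mul_le e sin_mem_H10
    rw [J_eq, inner_cosL sin_mem_H10, sub_self, zero_sub] at h1
    have h2 := (abs_le.1 (abs_inner_mulOp_le e sinL)).1
    refine le_of_mul_le_mul_right (h1.trans ?_) (pow_pos h0 2)
    change -inner ℝ (mulOp e sinL) sinL ≤ ‖e‖ * ‖sinL‖ ^ 2
    linarith

/-! ### Completeness of the sines -/

/-- Induction on `n` by `2 sin ((k+1) x) cos x = sin ((k+2) x) + sin (k x)`. With `k = 1` this gives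
orthogonality to `sin x` times any polynomial in `cos x`. -/
theorem integral_mul_sin_mul_cos_pow {u : L2}
    (h : ∀ j : ℕ, 1 ≤ j → ∫ x in Ioo 0 Real.pi, u x * Real.sin (j * x) = 0) (n k : ℕ) :
    ∫ x in Ioo 0 Real.pi, u x * (Real.sin (k * x) * Real.cos x ^ n) = 0 := by
  have hint : ∀ k n : ℕ,
      Integrable (fun x => u x * (Real.sin (k * x) * Real.cos x ^ n)) μI := fun k n => by
    refine (integrableOn_coe u).mul_bdd (c := 1) ?_ (.of_forall fun x => ?_)
    · exact (by fun_prop : Continuous fun x : ℝ => Real.sin (k * x) * Real.cos x ^ n)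
        |>.aestronglyMeasurable
    · rw [norm_mul, norm_pow]
      exact mul_le_one₀ (Real.abs_sin_le_one _) (by positivity)
        (pow_le_one₀ (norm_nonneg _) (Real.abs_cos_le_one _))
  induction n generalizing k with
  | zero =>
    rcases Nat.eq_zero_or_pos k with rfl | hk
    · simp
    · simpa using h k hk
  | succ n ih =>
    rcases k with _ | k
    · simp
    · have e1 : ∀ x, u x * (Real.sin ((k + 1 : ℕ) * x) * Real.cos x ^ (n + 1))
          = 2⁻¹ * (u x * (Real.sin ((k + 2 : ℕ) * x) * Real.cos x ^ n))
            + 2⁻¹ * (u x * (Real.sin (k * x) * Real.cos x ^ n)) := fun x => by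
        have a1 : ((k + 2 : ℕ) : ℝ) * x = (k + 1 : ℕ) * x + x := by push_cast; ring
        have a2 : (k : ℝ) * x = (k + 1 : ℕ) * x - x := by push_cast; ring
        rw [a1, a2, Real.sin_add, Real.sin_sub]
        ring
      simp_rw [e1]
      rw [integral_add ((hint _ _).const_mul _) ((hint _ _).const_mul _), integral_const_mul,
        integral_const_mul, ih, ih]
      simp

/-- Completeness of the functions `sin (j x)` in `L²(0,π)`. -/
theorem eq_zero_of_forall_integral_mul_sin {u : L2}
    (h : ∀ j : ℕ, 1 ≤ j → ∫ x in Ioo 0 Real.pi, u x * Real.sin (j * x) = 0) : u = 0 := by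
  have hu : Integrable (fun x => u x * Real.sin x) μI :=
    (integrableOn_coe u).mul_bdd (c := 1) Real.continuous_sin.aestronglyMeasurable
      (.of_forall fun x => Real.abs_sin_le_one x)
  have hmul : ∀ {g : ℝ → ℝ}, Continuous g → (∃ C, ∀ x, ‖g x‖ ≤ C) →
      Integrable (fun x => u x * Real.sin x * g x) μI := fun hg ⟨C, hC⟩ =>
    hu.mul_bdd hg.aestronglyMeasurable (.of_forall hC)
  have hcosP : ∀ P : Polynomial ℝ, ∃ C, ∀ x : ℝ, ‖P.eval (Real.cos x)‖ ≤ C := fun P => by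
    obtain ⟨C, hC⟩ := isCompact_Icc.exists_bound_of_continuousOn
      (s := Icc (-1 : ℝ) 1) P.continuous.continuousOn
    exact ⟨C, fun x => hC _ (Real.cos_mem_Icc x)⟩
  have hpoly : ∀ P : Polynomial ℝ,
      ∫ x in Ioo 0 Real.pi, u x * Real.sin x * P.eval (Real.cos x) = 0 := fun P => by
    have hP := hcosP
    induction P using Polynomial.induction_on' with
    | add P Q h1 h2 =>
      simp_rw [Polynomial.eval_add, mul_add]
      rw [integral_add (hmul (by fun_prop) (hP P)) (hmul (by fun_prop) (hP Q)), h1, h2, add_zero]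
    | monomial n a =>
      have e1 : ∀ x, u x * Real.sin x * Polynomial.eval (Real.cos x) (Polynomial.monomial n a)
          = a * (u x * (Real.sin ((1 : ℕ) * x) * Real.cos x ^ n)) := fun x => by
        rw [Polynomial.eval_monomial, Nat.cast_one, one_mul]; ring
      simp_rw [e1]
      rw [integral_const_mul, integral_mul_sin_mul_cos_pow h, mul_zero]
  have hcont : ∀ g : ℝ → ℝ, Continuous g → (∃ C, ∀ x, ‖g x‖ ≤ C) →
      ∫ x in Ioo 0 Real.pi, u x * Real.sin x * g x = 0 := by
    intro g hg hgC
    set A := ∫ x in Ioo 0 Real.pi, ‖u x * Real.sin x‖ with hA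
    have hA0 : 0 ≤ A := integral_nonneg fun x => norm_nonneg _
    rw [← norm_le_zero_iff]
    refine le_of_forall_pos_le_add fun ε hε => ?_
    -- Weierstrass in the variable `cos x`, which is injective on `[0, π]`; `A + 1` avoids dividing
    -- by zero.
    obtain ⟨P, hP⟩ := exists_polynomial_near_of_continuousOn (-1) 1 (fun y => g (Real.arccos y))
      (hg.comp Real.continuous_arccos).continuousOn (ε / (A + 1)) (by positivity)
    have e1 : ∫ x in Ioo 0 Real.pi, u x * Real.sin x * g x
        = ∫ x in Ioo 0 Real.pi, (u x * Real.sin x * g x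
          - u x * Real.sin x * P.eval (Real.cos x)) := by
      rw [integral_sub (hmul hg hgC) (hmul (by fun_prop) (hcosP P)), hpoly, sub_zero]
    rw [e1, zero_add]
    calc _ ≤ ∫ x in Ioo 0 Real.pi, ε / (A + 1) * ‖u x * Real.sin x‖ := by
          refine norm_integral_le_of_norm_le (hu.norm.const_mul _) ?_
          filter_upwards [ae_restrict_mem measurableSet_Ioo] with x hx
          have h1 := hP (Real.cos x) (Real.cos_mem_Icc x)
          rw [Real.arccos_cos hx.1.le hx.2.le, abs_sub_comm] at h1
          rw [← mul_sub, norm_mul, mul_comm]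
          exact mul_le_mul_of_nonneg_right h1.le (norm_nonneg _)
      _ = ε / (A + 1) * A := integral_const_mul _ _
      _ ≤ ε := by
          rw [div_mul_eq_mul_div, div_le_iff₀ (by positivity)]
          nlinarith
  have hz : ∀ᵐ x, x ∈ Ioo 0 Real.pi → u x * Real.sin x = 0 := by
    refine isOpen_Ioo.ae_eq_zero_of_integral_contDiff_smul_eq_zero
      (IntegrableOn.locallyIntegrableOn hu) fun g g0 g1 g2 => ?_
    rw [← setIntegral_eq_integral_of_forall_compl_eq_zero (s := Ioo 0 Real.pi) fun x hx => by
      rw [image_eq_zero_of_notMem_tsupport fun h => hx (g2 h), zero_smul]]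
    refine (integral_congr_ae (.of_forall fun x => ?_)).trans
      (hcont g g0.continuous (g1.exists_bound_of_continuous g0.continuous))
    simp only [smul_eq_mul]; ring
  refine Lp.ext ?_
  filter_upwards [ae_restrict_of_ae hz, ae_restrict_mem measurableSet_Ioo,
    Lp.coeFn_zero ℝ 2 μI] with x h1 h2 h3
  rw [h3]
  exact (mul_eq_zero.1 (h1 h2)).resolve_right (Real.sin_pos_of_mem_Ioo h2).ne'

/-! ### Solvability of the periodic problem -/

/-- The periodic problem is solvable if and only if the right-hand side is orthogonal to the
kernel of the elliptic form. -/
theorem hasPeriodicSolution_iff_inKernel {e : C0} {T : ℝ} (hT : 0 < T) {f : L2} :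
    HasPeriodicSolution e T f ↔ ∀ v, InKernel e v → inner ℝ f (prim v) = 0 := by
  constructor
  · rintro ⟨y, ⟨hy, yx, -, hyx, hw⟩, hper⟩ v hv
    have hX : (prim v, v) ∈ H10 := prim_mem_H10 hv.1
    set c : ℝ := inner ℝ f (prim v) with hc
    -- The equation tested with the kernel element says that `k` has zero weak derivative, hence is
    -- constant.
    let k : ℝ → ℝ := fun t => inner ℝ (y t) (prim v) - c * t
    have hk : ContinuousOn k (Icc 0 T) :=
      (hy.inner continuousOn_const).sub (by fun_prop)
    have hh : ContinuousOn (fun t => inner ℝ (y t) (prim v)) (Icc 0 T) :=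
      hy.inner continuousOn_const
    obtain ⟨C, hC⟩ := ae_eq_const_of_integral_mul_deriv_eq_zero hT
      (hk.integrableOn_Icc.mono_set Ioo_subset_Icc_self) fun η h0 h1 h2 => by
        have hd : Continuous (deriv η) := h0.continuous_deriv (by norm_num)
        have w1 := hw _ hX η h0 h1 h2
        have w2 : ∫ t in Ioo 0 T, J e (y t, yx t) (prim v, v) * η t = 0 := by
          refine (integral_congr_ae (g := fun _ => (0 : ℝ)) ?_).trans (by simp)
          filter_upwards [hyx] with t ht
          rw [J_comm, hv.2 _ ht, zero_mul]
        have w3 : ∫ t in Ioo 0 T, pairing f (prim v) * η t = c * ∫ t in Ioo 0 T, η t := by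
          rw [integral_const_mul, pairing_eq]
        have w4 : ∫ t in Ioo 0 T, deriv (fun t => t * η t) t = 0 := by
          refine integral_deriv_testFunction (contDiff_id.mul h0) (h1.mul_left (f := id)) ?_
          exact (tsupport_mul_subset_right (f := id)).trans h2
        have i1 : IntegrableOn η (Ioo 0 T) :=
          (h0.continuous.integrable_of_hasCompactSupport h1).integrableOn
        have i2 : IntegrableOn (fun t => t * deriv η t) (Ioo 0 T) :=
          ((continuous_id.mul hd).integrable_of_hasCompactSupport
            (h1.deriv.mul_left (f := id))).integrableOn
        have i3 : IntegrableOn (fun t => inner ℝ (y t) (prim v) * deriv η t) (Ioo 0 T) :=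
          integrableOn_mul_of_testFunction
            (hh.integrableOn_Icc.mono_set Ioo_subset_Icc_self) hd h1.deriv
        have w5 : (∫ t in Ioo 0 T, η t) + ∫ t in Ioo 0 T, t * deriv η t = 0 := by
          refine (integral_add i1 i2).symm.trans
            ((integral_congr_ae (.of_forall fun t => ?_)).trans w4)
          have h' : deriv (fun t => t * η t) t = 1 * η t + t * deriv η t :=
            ((hasDerivAt_id' t).mul
              (h0.differentiable (by norm_num) t).hasDerivAt).deriv
          simp only [h', one_mul]
        have w6 : ∫ t in Ioo 0 T, k t * deriv η t
            = (∫ t in Ioo 0 T, inner ℝ (y t) (prim v) * deriv η t)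
              - c * ∫ t in Ioo 0 T, t * deriv η t := by
          rw [← integral_const_mul, ← integral_sub i3 (i2.const_mul c)]
          refine integral_congr_ae (.of_forall fun t => ?_)
          simp only [k]; ring
        rw [w2, w3, add_zero] at w1
        simp only [pairing_eq] at w1
        rw [w6]
        linear_combination -w1 - c * w5
    have hC' : k =ᵐ[volume.restrict (Icc 0 T)] fun _ => C := by
      rw [← restrict_Ioo_eq_restrict_Icc]; exact hC
    -- Continuity of `y` in time extends the a.e. identity to the endpoints, where periodicity gives
    -- `c * T = 0`.
    have heq := Measure.eqOn_Icc_of_ae_eq volume hT.ne hC' hk continuousOn_const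
    have h0 := heq (left_mem_Icc.2 hT.le)
    have h1 := heq (right_mem_Icc.2 hT.le)
    simp only [k, hper] at h0 h1
    have : c * T = 0 := by linarith
    exact (mul_eq_zero.1 this).resolve_right hT.ne'
  · intro hf
    obtain ⟨p, hp, h⟩ := exists_forall_J_eq hf
    -- The elliptic solution, taken constant in time.
    refine ⟨fun _ => p.1, ⟨continuousOn_const, fun _ => p.2, memLp_const _,
      .of_forall fun _ => hp, fun q hq η h0 h1 h2 => ?_⟩, rfl⟩
    rw [integral_const_mul, integral_const_mul, integral_const_mul,
      integral_deriv_testFunction h0 h1 h2, h q hq, pairing_eq f,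
      mul_zero, neg_zero, zero_add]

theorem isEigenfunction_zero_iff {e : C0} {X : L2} :
    IsEigenfunction e 0 X ↔ X ≠ 0 ∧ ∃ v, InKernel e v ∧ X = prim v := by
  refine and_congr_right fun _ => ⟨?_, ?_⟩
  · rintro ⟨v, hv, h⟩
    obtain ⟨h1, h2⟩ := mem_H10_iff.1 hv
    exact ⟨v, ⟨h2, fun q hq => by rw [← h1]; simpa using h q hq⟩, h1⟩
  · rintro ⟨v, hv, rfl⟩
    exact ⟨v, prim_mem_H10 hv.1, fun q hq => by rw [hv.2 q hq, zero_mul]⟩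

theorem IsEigenfunction.exists_smul_eq {e : C0} {X Y : L2} (hX : IsEigenfunction e 0 X)
    (hY : IsEigenfunction e 0 Y) : ∃ c : ℝ, Y = c • X := by
  obtain ⟨h0, v, hv, rfl⟩ := isEigenfunction_zero_iff.1 hX
  obtain ⟨-, w, hw, rfl⟩ := isEigenfunction_zero_iff.1 hY
  obtain ⟨c, hc⟩ := hv.exists_smul_eq hw (by rintro rfl; simp at h0)
  exact ⟨c, by rw [hc, map_smul]⟩

theorem IsEigenfunction.smul {e : C0} {X : L2} (hX : IsEigenfunction e 0 X) {c : ℝ}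
    (hc : c ≠ 0) : IsEigenfunction e 0 (c • X) := by
  obtain ⟨h0, ux, hux, h⟩ := hX
  refine ⟨smul_ne_zero hc h0, c • ux, smul_mem_H10 c hux, fun q hq => ?_⟩
  have h1 := J_smul_left e c (X, ux) q
  rw [h q hq, zero_mul, mul_zero] at h1
  rw [zero_mul]
  exact h1

theorem hasPeriodicSolution_iff_forall {e : C0} {T : ℝ} (hT : 0 < T) {f : L2} :
    HasPeriodicSolution e T f ↔ ∀ X, IsEigenfunction e 0 X → inner ℝ f X = 0 := by
  rw [hasPeriodicSolution_iff_inKernel hT]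
  constructor
  · intro h X hX
    obtain ⟨-, v, hv, rfl⟩ := isEigenfunction_zero_iff.1 hX
    exact h v hv
  · intro h v hv
    by_cases h0 : prim v = 0
    · rw [h0, inner_zero_right]
    · exact h _ (isEigenfunction_zero_iff.2 ⟨h0, v, hv, rfl⟩)

theorem hasPeriodicSolution_iff {e : C0} {T : ℝ} (hT : 0 < T) {f X : L2}
    (hX : IsEigenfunction e 0 X) : HasPeriodicSolution e T f ↔ inner ℝ f X = 0 := by
  rw [hasPeriodicSolution_iff_forall hT]
  refine ⟨fun h => h X hX, fun h Y hY => ?_⟩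
  obtain ⟨c, rfl⟩ := hX.exists_smul_eq hY
  rw [real_inner_smul_right, h, mul_zero]

/-! ### The shifted potential and the ideal case -/

theorem isEigenfunction_sinL : IsEigenfunction 0 0 sinL :=
  isEigenfunction_zero_iff.2 ⟨sinL_ne_zero, cosL, inKernel_cosL, prim_cosL.symm⟩

theorem J_shifted (e : C0) (p q : L2 × L2) :
    J (shifted e) p q = J e p q - firstEigenvalue e * inner ℝ p.1 q.1 := by
  rw [J_eq, J_eq, shifted, map_add, add_apply, mulOp_const, inner_add_left,
    real_inner_smul_left]
  ring

theorem isEigenfunction_shifted_iff {e : C0} {u : L2} :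
    IsEigenfunction (shifted e) 0 u ↔ IsEigenfunction e (firstEigenvalue e) u := by
  simp only [IsEigenfunction, J_shifted, pairing_eq, zero_mul, sub_eq_zero]

theorem exists_isEigenfunction_shifted (e : C0) : ∃ X, IsEigenfunction (shifted e) 0 X := by
  obtain ⟨X, hX⟩ := (isLeast_eigenvalues e).1
  rw [← firstEigenvalue_eq] at hX
  exact ⟨X, isEigenfunction_shifted_iff.2 hX⟩

theorem isEigenfunction_zero_zero_iff {u : L2} :
    IsEigenfunction 0 0 u ↔ ∃ c : ℝ, c ≠ 0 ∧ u =ᵐ[μI] fun x => c * Real.sin x := by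
  constructor
  · intro hu
    obtain ⟨c, rfl⟩ := isEigenfunction_sinL.exists_smul_eq hu
    refine ⟨c, fun h => hu.1 (by rw [h, zero_smul]), ?_⟩
    filter_upwards [Lp.coeFn_smul c sinL, sinL_ae] with x h1 h2
    rw [h1, Pi.smul_apply, h2, smul_eq_mul]
  · rintro ⟨c, hc, h⟩
    have : u = c • sinL := by
      refine Lp.ext ?_
      filter_upwards [h, Lp.coeFn_smul c sinL, sinL_ae] with x h0 h1 h2
      rw [h0, h1, Pi.smul_apply, h2, smul_eq_mul]
    rw [this]
    exact isEigenfunction_sinL.smul hc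

theorem inner_sinL (f : L2) : inner ℝ f sinL = ∫ x in Ioo 0 Real.pi, f x * Real.sin x := by
  rw [inner_eq]
  refine integral_congr_ae ?_
  filter_upwards [sinL_ae] with x hx
  rw [hx]

/-! ### Detecting a nonzero potential by a sine -/

theorem eq_zero_of_forall_inner_test {u : L2} (h : ∀ q ∈ testPairs, inner ℝ u q.1 = 0) :
    u = 0 := by
  have hz : ∀ᵐ x, x ∈ Ioo 0 Real.pi → u x = 0 := by
    refine isOpen_Ioo.ae_eq_zero_of_integral_contDiff_smul_eq_zero
      (integrableOn_coe u).locallyIntegrableOn fun φ h0 h1 h2 => ?_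
    rw [← setIntegral_eq_integral_of_forall_compl_eq_zero (s := Ioo 0 Real.pi) fun x hx => by
      rw [image_eq_zero_of_notMem_tsupport fun h => hx (h2 h), zero_smul]]
    obtain ⟨q, hq, a1, -⟩ := exists_testPair h0 h1 h2
    have := h q hq
    rw [inner_eq] at this
    refine (integral_congr_ae ?_).trans this
    filter_upwards [a1] with x hx
    rw [hx, smul_eq_mul, mul_comm]
  refine Lp.ext ?_
  filter_upwards [ae_restrict_of_ae hz, ae_restrict_mem measurableSet_Ioo,
    Lp.coeFn_zero ℝ 2 μI] with x h1 h2 h3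
  rw [h3]
  exact h1 h2

/-- If `sin` is in the kernel for the potential `g`, then `g = 0`. -/
theorem eq_zero_of_isEigenfunction_sinL {g : C0} (h : IsEigenfunction g 0 sinL) : g = 0 := by
  obtain ⟨-, v, hv, hs⟩ := isEigenfunction_zero_iff.1 h
  have h1 : ∀ q ∈ H10, inner ℝ (v - cosL) q.2 = inner ℝ (mulOp g sinL) q.1 := fun q hq => by
    have h2 := hv.2 q hq
    rw [J_eq, ← hs] at h2
    rw [inner_sub_left, inner_cosL hq]
    change inner ℝ v q.2 - inner ℝ sinL q.1 - inner ℝ (mulOp g sinL) q.1 = 0 at h2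
    linarith
  -- Both `v` and `cosL` have primitive `sinL`, so testing with their difference leaves only its
  -- squared norm.
  have hd : v - cosL = 0 := by
    have h2 := h1 _ (prim_mem_H10 (sub_mem hv.1 cosL_mem_meanZero))
    change inner ℝ (v - cosL) (v - cosL) = inner ℝ _ (prim (v - cosL)) at h2
    rw [map_sub, ← hs, prim_cosL, sub_self, inner_zero_right] at h2
    exact inner_self_eq_zero.1 h2
  have hm : mulOp g sinL = 0 := eq_zero_of_forall_inner_test fun q hq => by
    rw [← h1 q (subset_closure hq), hd, inner_zero_left]
  have hae : val g =ᵐ[volume.restrict (Icc 0 Real.pi)] fun _ => 0 := by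
    rw [← restrict_Ioo_eq_restrict_Icc]
    have h2 := mulOp_ae g sinL
    rw [hm] at h2
    filter_upwards [h2, sinL_ae, Lp.coeFn_zero ℝ 2 μI, ae_restrict_mem measurableSet_Ioo]
      with x a1 a2 a3 hx
    rw [a3, a2] at a1
    exact (mul_eq_zero.1 a1.symm).resolve_right (Real.sin_pos_of_mem_Ioo hx).ne'
  have heq := Measure.eqOn_Icc_of_ae_eq volume Real.pi_pos.ne hae
    (continuous_val g).continuousOn continuousOn_const
  ext x
  rw [← val_of_mem g x.2]
  exact heq x.2

theorem shifted_ne_zero {e : C0} (he : ¬ IsConst e) : shifted e ≠ 0 := fun h =>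
  he ⟨-firstEigenvalue e, fun x => by
    have := DFunLike.congr_fun h x
    change e x + firstEigenvalue e = 0 at this
    linarith⟩

/-- The function `x ↦ sin (j x)` on `[0,π]`. -/
def sinMulC (j : ℕ) : C0 := ⟨fun x => Real.sin (j * x), by fun_prop⟩

theorem sinMulC_ae (j : ℕ) : toL2 (sinMulC j) =ᵐ[μI] fun x => Real.sin (j * x) := by
  filter_upwards [toL2_ae (sinMulC j), ae_restrict_mem measurableSet_Ioo] with x h1 h2
  exact h1.trans (val_of_mem _ (Ioo_subset_Icc_self h2))

theorem inner_sinMulC (u : L2) (j : ℕ) :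
    inner ℝ (toL2 (sinMulC j)) u = ∫ x in Ioo 0 Real.pi, u x * Real.sin (j * x) := by
  rw [inner_eq]
  refine integral_congr_ae ?_
  filter_upwards [sinMulC_ae j] with x hx
  rw [hx, mul_comm]

theorem sinMulC_one : toL2 (sinMulC 1) = sinL := by
  refine congrArg toL2 ?_
  ext x
  change Real.sin ((1 : ℕ) * x) = Real.sin x
  simp

theorem integral_sin_mul_mul_sin {j : ℕ} (hj : 2 ≤ j) :
    ∫ x in (0)..Real.pi, Real.sin (j * x) * Real.sin x = 0 := by
  have hj' : (2 : ℝ) ≤ j := by exact_mod_cast hj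
  have h1 : (j : ℝ) - 1 ≠ 0 := by linarith
  have h2 : (j : ℝ) + 1 ≠ 0 := by linarith
  have hder : ∀ x ∈ uIcc 0 Real.pi, HasDerivAt
      (fun x => 2⁻¹ * (Real.sin ((j - 1) * x) / (j - 1) - Real.sin ((j + 1) * x) / (j + 1)))
      (Real.sin (j * x) * Real.sin x) x := fun x _ => by
    have d1 : HasDerivAt (fun x => Real.sin (((j : ℝ) - 1) * x))
        (Real.cos ((j - 1) * x) * ((j - 1) * 1)) x :=
      ((hasDerivAt_id' x).const_mul ((j : ℝ) - 1)).sin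
    have d2 : HasDerivAt (fun x => Real.sin (((j : ℝ) + 1) * x))
        (Real.cos ((j + 1) * x) * ((j + 1) * 1)) x :=
      ((hasDerivAt_id' x).const_mul ((j : ℝ) + 1)).sin
    refine (((d1.div_const _).sub (d2.div_const _)).const_mul 2⁻¹).congr_deriv ?_
    rw [mul_one, mul_one, mul_div_cancel_right₀ _ h1, mul_div_cancel_right₀ _ h2, sub_mul,
      add_mul, one_mul, Real.cos_sub, Real.cos_add]
    ring
  rw [intervalIntegral.integral_eq_sub_of_hasDerivAt hder
    ((by fun_prop : Continuous fun x : ℝ => Real.sin (j * x) * Real.sin x).intervalIntegrable _ _)]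
  have s1 : Real.sin (((j : ℝ) - 1) * Real.pi) = 0 := by
    have := Real.sin_int_mul_pi ((j : ℤ) - 1)
    push_cast at this
    exact this
  have s2 : Real.sin (((j : ℝ) + 1) * Real.pi) = 0 := by
    have := Real.sin_int_mul_pi ((j : ℤ) + 1)
    push_cast at this
    exact this
  rw [s1, s2]
  simp

theorem inner_sinMulC_sinL {j : ℕ} (hj : 2 ≤ j) : inner ℝ (toL2 (sinMulC j)) sinL = 0 := by
  rw [inner_sinL]
  refine (integral_congr_ae ?_).trans
    ((integral_Ioo_eq_interval _).trans (integral_sin_mul_mul_sin hj))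
  filter_upwards [sinMulC_ae j] with x hx
  rw [hx]

/-- A kernel element for a nonzero potential is detected by some `sin (j x)` with `j ≥ 2`. -/
theorem exists_inner_sinMulC_ne_zero {g : C0} (hg : g ≠ 0) {X : L2}
    (hX : IsEigenfunction g 0 X) : ∃ j : ℕ, 2 ≤ j ∧ inner ℝ (toL2 (sinMulC j)) X ≠ 0 := by
  by_contra! h
  have hs : inner ℝ sinL sinL ≠ 0 := fun h => sinL_ne_zero (inner_self_eq_zero.1 h)
  set c : ℝ := inner ℝ sinL X / inner ℝ sinL sinL with hc
  -- Were all coefficients with `j ≥ 2` zero, removing the `sin` component would leave something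
  -- orthogonal to every sine.
  have hX' : X - c • sinL = 0 := eq_zero_of_forall_integral_mul_sin fun j hj => by
    rw [← inner_sinMulC, inner_sub_right, real_inner_smul_right]
    rcases hj.eq_or_lt with rfl | hj
    · rw [sinMulC_one, hc, div_mul_cancel₀ _ hs, sub_self]
    · rw [h j hj, inner_sinMulC_sinL hj, mul_zero, sub_zero]
  rw [sub_eq_zero] at hX'
  have hc0 : c ≠ 0 := fun h0 => hX.1 (by rw [hX', h0, zero_smul])
  have hsin : c⁻¹ • X = sinL := by rw [hX', smul_smul, inv_mul_cancel₀ hc0, one_smul]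
  exact hg (eq_zero_of_isEigenfunction_sinL (hsin ▸ hX.smul (inv_ne_zero hc0)))

/-! ### Loss of periodicity and density -/

theorem norm_shifted_le (e : C0) : ‖shifted e‖ ≤ 2 * ‖e‖ := by
  have h : ‖(ContinuousMap.const _ (firstEigenvalue e) : C0)‖ ≤ ‖e‖ :=
    (ContinuousMap.norm_le _ (norm_nonneg e)).2 fun _ => abs_firstEigenvalue_le e
  calc _ ≤ ‖e‖ + ‖(ContinuousMap.const _ (firstEigenvalue e) : C0)‖ := norm_add_le _ _
    _ ≤ _ := by linarith

theorem exists_hasPeriodicSolution_not {e : C0} (he : ¬ IsConst e) {T : ℝ} (hT : 0 < T) :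
    ∃ j : ℕ, 2 ≤ j ∧ HasPeriodicSolution 0 T (toL2 (sinMulC j)) ∧
      ¬ HasPeriodicSolution (shifted e) T (toL2 (sinMulC j)) := by
  obtain ⟨X, hX⟩ := exists_isEigenfunction_shifted e
  obtain ⟨j, hj, h⟩ := exists_inner_sinMulC_ne_zero (shifted_ne_zero he) hX
  refine ⟨j, hj, ?_, ?_⟩
  · rw [hasPeriodicSolution_iff hT isEigenfunction_sinL]
    exact inner_sinMulC_sinL hj
  · rwa [hasPeriodicSolution_iff hT hX]

theorem exists_not_isConst_norm_lt {ε : ℝ} (hε : 0 < ε) : ∃ e : C0, ¬ IsConst e ∧ ‖e‖ < ε := by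
  refine ⟨(ε / 2) • sinC, ?_, ?_⟩
  · rintro ⟨c, hc⟩
    have h1 := hc ⟨0, left_mem_Icc.2 Real.pi_pos.le⟩
    have h2 := hc ⟨Real.pi / 2, by constructor <;> linarith [Real.pi_pos]⟩
    change ε / 2 * Real.sin 0 = c at h1
    change ε / 2 * Real.sin (Real.pi / 2) = c at h2
    rw [Real.sin_zero] at h1
    rw [Real.sin_pi_div_two] at h2
    linarith
  · have h : ‖sinC‖ ≤ 1 := (ContinuousMap.norm_le _ zero_le_one).2 fun _ => Real.abs_sin_le_one _
    rw [norm_smul, Real.norm_of_nonneg (by positivity)]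
    nlinarith

/-- A line in direction `g` through a zero of `ℓ` meets the kernel of `ℓ` only at `t = 0`. The set
`s` need only be invariant under that direction, so the same argument serves all of `L²` and the
hyperplane of solvable right-hand sides. -/
theorem dense_compl_of_line {E : Type*} [AddCommGroup E] [Module ℝ E] [TopologicalSpace E]
    [ContinuousAdd E] [ContinuousSMul ℝ E] (ℓ : E →ₗ[ℝ] ℝ) {s : Set E} {g : E}
    (hs : ∀ f ∈ s, ∀ t : ℝ, f + t • g ∈ s) (hg : ℓ g ≠ 0) :
    Dense {f : s | ℓ f ≠ 0} := by
  intro f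
  by_cases hf : ℓ f = 0
  · let γ : ℝ → s := fun t => ⟨f + t • g, hs f f.2 t⟩
    have hγ : Continuous γ := by
      refine Continuous.subtype_mk ?_ _
      fun_prop
    have h0 : γ 0 = f := Subtype.ext (by simp [γ])
    rw [← h0]
    refine map_mem_closure hγ (s := {t : ℝ | t ≠ 0}) ((dense_compl_singleton (0 : ℝ)) 0) ?_
    intro t ht
    change ℓ (f + t • g) ≠ 0
    rw [map_add, hf, zero_add, map_smul, smul_eq_mul]
    exact mul_ne_zero ht hg
  · exact subset_closure hf

theorem dense_not_hasPeriodicSolution {e : C0} {T : ℝ} (hT : 0 < T) :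
    Dense {f : L2 | ¬ HasPeriodicSolution (shifted e) T f} := by
  obtain ⟨X, hX⟩ := exists_isEigenfunction_shifted e
  simp only [hasPeriodicSolution_iff hT hX]
  have h := dense_compl_of_line (innerₗ L2 X) (s := univ) (g := X) (fun _ _ _ => mem_univ _)
    (fun h => hX.1 (inner_self_eq_zero.1 h))
  intro f
  refine map_mem_closure continuous_subtype_val (h ⟨f, mem_univ f⟩) fun u hu hu' => hu ?_
  rw [innerₗ_apply_apply, real_inner_comm]
  exact hu'

end ParabolicExample

end

theorem mainTheorem4 :
    -- the first eigenvalue exists, is given by the minimum of the Rayleigh quotient, and is small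
    (∀ e : ParabolicExample.C0,
      IsLeast (ParabolicExample.eigenvalues e) (ParabolicExample.firstEigenvalue e) ∧
      IsLeast (ParabolicExample.rayleighValues e) (ParabolicExample.firstEigenvalue e) ∧
      |ParabolicExample.firstEigenvalue e| ≤ ‖e‖) ∧
    Tendsto ParabolicExample.firstEigenvalue (𝓝 0) (𝓝 0) ∧
    Tendsto ParabolicExample.shifted (𝓝 0) (𝓝 0) ∧
    -- the ideal case `e = 0`: the first eigenvalue is `0`, with eigenspace spanned by `sin x`
    ParabolicExample.firstEigenvalue 0 = 0 ∧
    (∀ u : ParabolicExample.L2, ParabolicExample.IsEigenfunction 0 0 u ↔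
      ∃ c : ℝ, c ≠ 0 ∧
        u =ᵐ[volume.restrict (Ioo (0 : ℝ) Real.pi)] fun x => c * Real.sin x) ∧
    ∀ T : ℝ, 0 < T →
      -- the solvability condition when `0` is an eigenvalue
      (∀ (e : ParabolicExample.C0) (f : ParabolicExample.L2),
        (0 : ℝ) ∈ ParabolicExample.eigenvalues e →
        (ParabolicExample.HasPeriodicSolution e T f ↔
          ∀ X : ParabolicExample.L2, ParabolicExample.IsEigenfunction e 0 X →
            (∫ x in Ioo (0 : ℝ) Real.pi, f x * X x) = 0)) ∧
      -- the ideal case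
      (∀ f : ParabolicExample.L2, ParabolicExample.HasPeriodicSolution 0 T f ↔
        (∫ x in Ioo (0 : ℝ) Real.pi, f x * Real.sin x) = 0) ∧
      -- the perturbation `e + λ_e`
      (∀ (e : ParabolicExample.C0) (φ : ParabolicExample.L2),
        ParabolicExample.IsEigenfunction e (ParabolicExample.firstEigenvalue e) φ → ‖φ‖ = 1 →
        ∀ f : ParabolicExample.L2,
          ParabolicExample.HasPeriodicSolution (ParabolicExample.shifted e) T f ↔
            (∫ x in Ioo (0 : ℝ) Real.pi, f x * φ x) = 0) ∧
      -- loss of periodicity for a non-constant `e`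
      (∀ e : ParabolicExample.C0, ¬ ParabolicExample.IsConst e →
        (∃ j : ℕ, 2 ≤ j ∧ ∃ f : ParabolicExample.L2,
          (f =ᵐ[volume.restrict (Ioo (0 : ℝ) Real.pi)] fun x => Real.sin ((j : ℝ) * x)) ∧
          ParabolicExample.HasPeriodicSolution 0 T f ∧
          ¬ ParabolicExample.HasPeriodicSolution (ParabolicExample.shifted e) T f) ∧
        IsOpen {f : ParabolicExample.L2 |
          ¬ ParabolicExample.HasPeriodicSolution (ParabolicExample.shifted e) T f} ∧
        Dense {f : ParabolicExample.L2 |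
          ¬ ParabolicExample.HasPeriodicSolution (ParabolicExample.shifted e) T f} ∧
        Dense {f : {f : ParabolicExample.L2 // ParabolicExample.HasPeriodicSolution 0 T f} |
          ¬ ParabolicExample.HasPeriodicSolution (ParabolicExample.shifted e) T f.1}) ∧
      -- arbitrarily small perturbations that destroy periodicity
      (∀ ε : ℝ, 0 < ε → ∃ e : ParabolicExample.C0, ¬ ParabolicExample.IsConst e ∧
        ‖ParabolicExample.shifted e‖ < ε ∧
        ∃ f : ParabolicExample.L2, ParabolicExample.HasPeriodicSolution 0 T f ∧
          ¬ ParabolicExample.HasPeriodicSolution (ParabolicExample.shifted e) T f) := by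
  open ParabolicExample in
  refine ⟨fun e => ?_, ?_, ?_, ?_, fun u => isEigenfunction_zero_zero_iff, fun T hT =>
    ⟨fun e f _ => ?_, fun f => ?_, fun e φ hφ _ f => ?_, fun e he => ⟨?_, ?_, ?_, ?_⟩, ?_⟩⟩
  · rw [firstEigenvalue_eq]
    refine ⟨isLeast_eigenvalues e, isLeast_rayleighValues e, ?_⟩
    rw [← firstEigenvalue_eq]
    exact abs_firstEigenvalue_le e
  · exact squeeze_zero_norm abs_firstEigenvalue_le tendsto_norm_zero
  · refine squeeze_zero_norm norm_shifted_le ?_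
    simpa using (tendsto_norm_zero (E := C0)).const_mul 2
  · simpa using abs_firstEigenvalue_le 0
  · simp only [hasPeriodicSolution_iff_forall hT, inner_eq]
  · rw [hasPeriodicSolution_iff hT isEigenfunction_sinL, inner_sinL]
  · rw [hasPeriodicSolution_iff hT (isEigenfunction_shifted_iff.2 hφ), inner_eq]
  · obtain ⟨j, hj, h⟩ := exists_hasPeriodicSolution_not he hT
    exact ⟨j, hj, _, sinMulC_ae j, h⟩
  · obtain ⟨X, hX⟩ := exists_isEigenfunction_shifted e
    simp only [hasPeriodicSolution_iff hT hX]
    exact isOpen_ne_fun (by fun_prop) continuous_const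
  · exact dense_not_hasPeriodicSolution hT
  · obtain ⟨j, -, h1, h2⟩ := exists_hasPeriodicSolution_not he hT
    obtain ⟨X, hX⟩ := exists_isEigenfunction_shifted e
    rw [hasPeriodicSolution_iff hT hX, real_inner_comm] at h2
    have h : Dense {f : {f : L2 // HasPeriodicSolution 0 T f} | innerₗ L2 X f.1 ≠ 0} :=
      -- Moving along `sin (j x)` preserves orthogonality to `sin` but changes the pairing with `X`.
      dense_compl_of_line (innerₗ L2 X) (s := {f | HasPeriodicSolution 0 T f})
      (g := toL2 (sinMulC j)) (fun f hf t => by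
        rw [mem_ofPred_eq, hasPeriodicSolution_iff hT isEigenfunction_sinL] at hf ⊢
        rw [hasPeriodicSolution_iff hT isEigenfunction_sinL] at h1
        rw [inner_add_left, real_inner_smul_left, hf, h1, mul_zero, add_zero]) h2
    refine h.mono fun (f : {f : L2 // HasPeriodicSolution 0 T f})
      (hf : innerₗ L2 X f.1 ≠ 0) (hp : HasPeriodicSolution (shifted e) T f.1) => hf ?_
    rw [innerₗ_apply_apply, real_inner_comm]
    exact (hasPeriodicSolution_iff hT hX).1 hp
  · intro ε hε
    -- Half of `ε`, since adding `λ_e` can at most double the norm.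
    obtain ⟨e, he, hn⟩ := exists_not_isConst_norm_lt (half_pos hε)
    obtain ⟨j, -, h⟩ := exists_hasPeriodicSolution_not he hT
    exact ⟨e, he, by linarith [norm_shifted_le e], _, h⟩
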